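/- **Setting.** Let $c>1$, $A=\frac{c-1}{24}$ and $T_{\rm gap}>0$. For every integer $J$ let $\rho_J(\Delta)\,d\Delta$ be a positive Borel measure on $\mathbb R$ (the spectral density of the spin-$J$ non-identity Virasoro primaries of a unitary two-dimensional CFT; it need not be discrete), supported in $\Delta-|J|>2T_{\rm gap}$ (twist gap), such that $\sum_J\int d\Delta\,\rho_J(\Delta)e^{-\beta\Delta-\mu J}$ converges absolutely whenever $\operatorname{Re}\beta>|\operatorname{Re}\mu|$. With $\rho(h,\bar h)=2\sum_J\rho_J(h+\bar h)\,\delta(J-\bar h+h)$ and $\eta(\beta)=e^{-\beta/24}\prod_{n\ge1}(1-e^{-n\beta})$, assume that the torus partition function $$Z(\beta_L,\beta_R)=\frac{e^{A(\beta_L+\beta_R)}}{\eta(\beta_L)\eta(\beta_R)}\Big[(1-e^{-\beta_L})(1-e^{-\beta_R})+\int_{T_{\rm gap}}^\infty\! dh\int_{T_{\rm gap}}^\infty\! d\bar h\,\rho(h,\bar h)e^{-h\beta_L-\bar h\beta_R}\Big],\qquad \operatorname{Re}\beta_L,\operatorname{Re}\beta_R>0,$$ is modular invariant: $Z(\beta_L,\beta_R)=Z(\beta_L+2\pi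 i,\beta_R-2\pi i)=Z\big(\tfrac{4\pi^2}{\beta_L},\tfrac{4\pi^2}{\beta_R}\big)$. **Vacuum density.** For $J\geq 1$ put $\alpha=2\pi\sqrt{A/J}$ and, for $\operatorname{Re}\beta_L>\alpha$, $$F_{\rm vac}(\beta_L,J)=\int_{\alpha-i\pi}^{\alpha+i\pi}\frac{dz}{2\pi i}\,e^{zJ}\sqrt{\frac{4\pi^2}{z(\beta_L-z)}}\;e^{\frac{4\pi^2A}{\beta_L-z}+\frac{4\pi^2A}{z}}\Big(1-e^{-\frac{4\pi^2}{\beta_L-z}}\Big)\Big(1-e^{-\frac{4\pi^2}{z}}\Big),$$ and define $\rho_{J,\rm vac}$ as its inverse Laplace transform, $$2\rho_{J,\rm vac}(J+2h)=\int_{\mathbb R}\frac{ds}{2\pi}\,F_{\rm vac}(\beta+is,J)\,e^{(\beta+is)(h-A)},$$ where $\beta>0$ is any fixed number (and $J$ is so large that $\beta>\alpha$). **Theorem.** Let $\varphi$ be a smooth function supported in $[-R,R]$, and set $\varphi_{h_*,\lambda}(h)=\frac1\lambda\varphi\big(\frac{h-h_*}{\lambda}\big)$. Let $\epsilon,\delta>0$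 be fixed and let $(\lambda_J)$ be a bounded sequence with $\lambda_J\ge\delta J^{-1/4+\epsilon}$ for all sufficiently large $J$. Then for every $p\in\mathbb N$ $$\int_{T_{\rm gap}}^\infty dh\,\varphi_{h_*,\lambda_J}(h)\big[\rho_J(J+2h)-\rho_{J,\rm vac}(J+2h)\big]=\frac{1}{\sqrt{2J}}\,e^{4\pi\sqrt{AJ}}\;o(J^{-p})\qquad(J\to\infty),$$ uniformly for $h_*$ in any bounded interval. For large $J$ all integrals involved converge absolutely. -/

import Mathlib

open MeasureTheory Filter Set
open scoped Real ContDiff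

noncomputable section

/-- The data of a two-dimensional CFT that enter its torus partition function: the central charge
`c`, half the twist gap `Tgap`, and for every integer spin `J` the spectral density
`ρ_J(Δ) dΔ` of the non-identity Virasoro primaries, a positive Borel measure in the scaling
dimension `Δ` (a sum of Dirac masses if the spectrum is discrete). -/
structure CFTData where
  /-- central charge -/
  c : ℝ
  /-- half of the twist gap -/
  Tgap : ℝ
  /-- `ρ_J(Δ) dΔ` -/
  rho : ℤ → Measure ℝ

/-- `A = (c - 1) / 24`. -/
def CFTData.A (S : CFTData) : ℝ := (S.c - 1) / 24

/-- The two-variable density `ρ(h, h̄) dh dh̄ = 2 ∑_J ρ_J(h + h̄) δ(J - h̄ + h) dh dh̄`, that is, the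
sum over `J` of the images of `ρ_J(Δ) dΔ` under `Δ ↦ (h, h̄) = ((Δ - J) / 2, (Δ + J) / 2)`. -/
def CFTData.pairDensity (S : CFTData) : Measure (ℝ × ℝ) :=
  Measure.sum fun J : ℤ => (S.rho J).map fun Δ : ℝ => ((Δ - J) / 2, (Δ + J) / 2)

/-- The Dedekind eta function in the variable `β`, `η(β) = e^{-β/24} ∏_{n ≥ 1} (1 - e^{-nβ})`
(Mathlib's eta function at `τ = iβ / (2π)`). -/
def etaBeta (β : ℂ) : ℂ := ModularForm.eta (Complex.I * β / (2 * π))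

/-- The torus partition function
`Z(β_L, β_R) = e^{A (β_L + β_R)} / (η(β_L) η(β_R)) *
  [(1 - e^{-β_L}) (1 - e^{-β_R}) + ∫∫_{h, h̄ > Tgap} ρ(h, h̄) e^{-h β_L - h̄ β_R} dh dh̄]`. -/
def CFTData.Z (S : CFTData) (βL βR : ℂ) : ℂ :=
  Complex.exp (S.A * (βL + βR)) / (etaBeta βL * etaBeta βR) *
    ((1 - Complex.exp (-βL)) * (1 - Complex.exp (-βR)) +
      ∫ x in Ioi S.Tgap ×ˢ Ioi S.Tgap,
        Complex.exp (-(x.1 : ℂ) * βL - (x.2 : ℂ) * βR) ∂S.pairDensity)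

/-- The standing assumptions: `c > 1`, a positive twist gap, convergence of the character sums, and
modular invariance of the torus partition function. -/
structure CFTData.IsModularCFT (S : CFTData) : Prop where
  one_lt_c : 1 < S.c
  Tgap_pos : 0 < S.Tgap
  /-- every `ρ_J` lives on `Δ - |J| > 2 Tgap` -/
  twist_gap : ∀ J : ℤ, S.rho J (Iic (|(J : ℝ)| + 2 * S.Tgap)) = 0
  /-- `∑_J ∫ ρ_J(Δ) e^{-βΔ - μJ} dΔ` converges absolutely for `Re β > |Re μ|` -/
  convergent : ∀ β μ : ℝ, |μ| < β →
    (∑' J : ℤ, ∫⁻ Δ, ENNReal.ofReal (Real.exp (-β * Δ - μ * J)) ∂S.rho J) ≠ ⊤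
  /-- invariance under the modular transformation `T` -/
  modular_T : ∀ βL βR : ℂ, 0 < βL.re → 0 < βR.re →
    S.Z (βL + 2 * π * Complex.I) (βR - 2 * π * Complex.I) = S.Z βL βR
  /-- invariance under the modular transformation `S` -/
  modular_S : ∀ βL βR : ℂ, 0 < βL.re → 0 < βR.re →
    S.Z (4 * π ^ 2 / βL) (4 * π ^ 2 / βR) = S.Z βL βR

/-- The measure `ρ_J(J + 2h) dh` on the `h`-line. Since `Δ = J + 2h` and `dh = dΔ / 2`, it is half
of the image of `ρ_J(Δ) dΔ` under `Δ ↦ h = (Δ - J) / 2`. -/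
def CFTData.rhoH (S : CFTData) (J : ℤ) : Measure ℝ :=
  (2⁻¹ : NNReal) • (S.rho J).map fun Δ : ℝ => (Δ - J) / 2

/-- `α = 2π √(A / J)`, the real part of the `z`-contour. -/
def alphaJ (A : ℝ) (J : ℤ) : ℝ := 2 * π * √(A / J)

/-- The integrand of the vacuum term as a function of `β_L` and `z`,
`√(4π² / (z (β_L - z))) e^{zJ + 4π²A/(β_L - z) + 4π²A/z} (1 - e^{-4π²/(β_L - z)}) (1 - e^{-4π²/z})`
(principal square root; `z` and `β_L - z` lie in the right half plane where it is used). -/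
def vacIntegrand (A : ℝ) (J : ℤ) (βL z : ℂ) : ℂ :=
  Complex.exp (z * J) * (4 * π ^ 2 / (z * (βL - z))) ^ (1 / 2 : ℂ) *
    Complex.exp (4 * π ^ 2 * A / (βL - z) + 4 * π ^ 2 * A / z) *
    (1 - Complex.exp (-(4 * π ^ 2 / (βL - z)))) * (1 - Complex.exp (-(4 * π ^ 2 / z)))

/-- The vacuum term `F_vac(β_L, J) = ∫ dz / (2πi) (...)` along the segment `z = α + it`,
`-π ≤ t ≤ π`; along it `dz / (2πi) = dt / (2π)`. -/
def Fvac (A : ℝ) (βL : ℂ) (J : ℤ) : ℂ :=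
  ∫ t in (-π)..π, (1 / (2 * π) : ℂ) *
    vacIntegrand A J βL ((alphaJ A J : ℂ) + (t : ℂ) * Complex.I)

/-- The integrand `(2π)⁻¹ F_vac(β + is, J) e^{(β + is)(h - A)}` of the inverse Laplace transform. -/
def rhoVacIntegrand (A β : ℝ) (J : ℤ) (h s : ℝ) : ℂ :=
  (1 / (2 * π) : ℂ) * Fvac A ((β : ℂ) + (s : ℂ) * Complex.I) J *
    Complex.exp (((β : ℂ) + (s : ℂ) * Complex.I) * ((h : ℂ) - A))

/-- The vacuum density `ρ_{J,vac}(J + 2h)`, defined by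
`2 ρ_{J,vac}(J + 2h) = ∫ ds / (2π) F_vac(β + is, J) e^{(β + is)(h - A)}`. The abscissa `β` of the
inverse Laplace transform is any number `β > α = 2π √(A / J)`. -/
def rhoVac (A β : ℝ) (J : ℤ) (h : ℝ) : ℂ :=
  (1 / 2 : ℂ) * ∫ s : ℝ, rhoVacIntegrand A β J h s

/-- The rescaled and translated test function `φ_{h⋆,λ}(h) = λ⁻¹ φ((h - h⋆) / λ)`. -/
def rescale (φ : ℝ → ℂ) (hstar lam : ℝ) (h : ℝ) : ℂ :=
  (lam : ℂ)⁻¹ * φ ((h - hstar) / lam)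

end

/-!
Modular invariance under `T` makes the reduced partition function `2πi`-periodic along
`(β_L, β_R) ↦ (β_L - z, z)`, so its Fourier modes in `z` are the Laplace transforms of the spin-`J`
densities. Applying `S` under the Fourier integral, the vacuum of the dual channel yields `Fvac`,
while every other dual primary has `h ≥ Tgap > 0`; at bounded `Im β_L` it is therefore suppressed
by `e^{-κ√J}` on the contour `Re z = 2π√(A/J)`, and this deteriorates only like `e^{K(Im β_L)²}`.
By positivity of the densities the remainder is, at every `Im β_L`, at most of the order of the
vacuum at `Im β_L = 0`. Parseval writes the smeared difference as an integral of this remainder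
against the Laplace transform of the test function, which decays faster than any power of
`λ |Im β_L|`. Cutting at `|Im β_L| = J^{1/4 - ε/2}`, the remainder is exponentially small below the
cut, and above it any power of `λ |Im β_L| ≥ δ J^{ε/2}` may be gained.
-/

noncomputable section

open Complex (I)
open scoped Topology FourierTransform

/-! ### The modular transformation of the eta function -/

theorem arg_add_arg_mem_Ioo {z w : ℂ} (hz : 0 < z.re) (hw : 0 < w.re) :
    z.arg + w.arg ∈ Ioo (-π) π := by
  have hz' := abs_lt.1 (Complex.abs_arg_lt_pi_div_two_iff.2 (Or.inl hz))
  have hw' := abs_lt.1 (Complex.abs_arg_lt_pi_div_two_iff.2 (Or.inl hw))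
  constructor <;> linarith

theorem mul_mem_slitPlane_of_re_pos {z w : ℂ} (hz : 0 < z.re) (hw : 0 < w.re) :
    z * w ∈ Complex.slitPlane := by
  have hz₀ := Complex.ne_zero_of_re_pos hz
  have hw₀ := Complex.ne_zero_of_re_pos hw
  have harg := arg_add_arg_mem_Ioo hz hw
  rw [Complex.mem_slitPlane_iff_arg, Complex.arg_mul hz₀ hw₀ (Ioo_subset_Ioc_self harg)]
  exact ⟨harg.2.ne, mul_ne_zero hz₀ hw₀⟩

theorem mul_cpow_of_arg_add_mem {z w : ℂ} (hz : z ≠ 0) (hw : w ≠ 0)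
    (h : z.arg + w.arg ∈ Ioc (-π) π) (r : ℂ) : (z * w) ^ r = z ^ r * w ^ r := by
  rw [Complex.cpow_def_of_ne_zero (mul_ne_zero hz hw), Complex.cpow_def_of_ne_zero hz,
    Complex.cpow_def_of_ne_zero hw, Complex.log_mul hz hw h, add_mul, Complex.exp_add]

theorem norm_cpow_one_half (z : ℂ) : ‖z ^ (1 / 2 : ℂ)‖ = √‖z‖ := by
  rw [show (1 / 2 : ℂ) = ((1 / 2 : ℝ) : ℂ) by push_cast; rfl, Complex.norm_cpow_real,
    Real.sqrt_eq_rpow]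

theorem re_ofReal_div_pos {r : ℝ} {z : ℂ} (hr : 0 < r) (hz : 0 < z.re) : 0 < (r / z : ℂ).re := by
  have := Complex.normSq_pos.2 (Complex.ne_zero_of_re_pos hz)
  rw [div_eq_mul_inv, Complex.re_ofReal_mul, Complex.inv_re]
  positivity

theorem re_div_ofReal_pos {r : ℝ} {z : ℂ} (hr : 0 < r) (hz : 0 < z.re) : 0 < (z / r : ℂ).re := by
  rw [Complex.div_ofReal_re]
  exact div_pos hz hr

theorem re_four_pi_sq_div (z : ℂ) :
    (4 * (π : ℂ) ^ 2 / z).re = 4 * π ^ 2 * z.re / Complex.normSq z := by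
  rw [show 4 * (π : ℂ) ^ 2 = ((4 * π ^ 2 : ℝ) : ℂ) by push_cast; rfl, div_eq_mul_inv,
    Complex.re_ofReal_mul, Complex.inv_re, mul_div_assoc]

theorem re_four_pi_sq_div_pos {z : ℂ} (hz : 0 < z.re) : 0 < (4 * (π : ℂ) ^ 2 / z).re := by
  rw [re_four_pi_sq_div]
  exact div_pos (by positivity) (Complex.normSq_pos.2 (Complex.ne_zero_of_re_pos hz))

theorem four_pi_sq_div_mul_mem_slitPlane {z w : ℂ} (hz : 0 < z.re) (hw : 0 < w.re) :
    4 * (π : ℂ) ^ 2 / (z * w) ∈ Complex.slitPlane := by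
  have h := mul_mem_slitPlane_of_re_pos (re_ofReal_div_pos Real.two_pi_pos hz)
    (re_ofReal_div_pos Real.two_pi_pos hw)
  convert h using 1
  push_cast
  ring

theorem four_pi_sq_div_mul_cpow {z w : ℂ} (hz : 0 < z.re) (hw : 0 < w.re) (r : ℂ) :
    (4 * (π : ℂ) ^ 2 / (z * w)) ^ r = ((z / (2 * π)) ^ r * (w / (2 * π)) ^ r)⁻¹ := by
  have hz' : 0 < (z / (2 * π)).re := by exact_mod_cast re_div_ofReal_pos Real.two_pi_pos hz
  have hw' : 0 < (w / (2 * π)).re := by exact_mod_cast re_div_ofReal_pos Real.two_pi_pos hw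
  have hslit := mul_mem_slitPlane_of_re_pos hz' hw'
  have hinv : 4 * (π : ℂ) ^ 2 / (z * w) = (z / (2 * π) * (w / (2 * π)))⁻¹ := by
    rw [div_mul_div_comm, inv_div]
    ring
  rw [hinv, Complex.inv_cpow _ _ (Complex.mem_slitPlane_iff_arg.1 hslit).1,
    mul_cpow_of_arg_add_mem (Complex.ne_zero_of_re_pos hz') (Complex.ne_zero_of_re_pos hw')
      (Ioo_subset_Ioc_self (arg_add_arg_mem_Ioo hz' hw'))]

theorem etaBeta_ne_zero {b : ℂ} (hb : 0 < b.re) : etaBeta b ≠ 0 := by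
  refine ModularForm.eta_ne_zero ?_
  have him : (I * b / (2 * π)).im = b.re / (2 * π) := by
    rw [show (2 * π : ℂ) = ((2 * π : ℝ) : ℂ) by push_cast; rfl, Complex.div_ofReal_im]
    simp
  have : 0 < (I * b / (2 * π)).im := by
    rw [him]
    positivity
  simpa [UpperHalfPlane.upperHalfPlaneSet] using this

theorem etaBeta_four_pi_sq_div {b : ℂ} (hb : 0 < b.re) :
    etaBeta (4 * π ^ 2 / b) = (b / (2 * π)) ^ (1 / 2 : ℂ) * etaBeta b := by
  have hz : 0 < (b / (2 * π)).re := by exact_mod_cast re_div_ofReal_pos Real.two_pi_pos hb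
  have hb₀ := Complex.ne_zero_of_re_pos hb
  have hsqrt : Complex.sqrt (I * (b / (2 * π))) =
      Complex.sqrt I * (b / (2 * π)) ^ (1 / 2 : ℂ) := by
    have harg := abs_lt.1 (Complex.abs_arg_lt_pi_div_two_iff.2 (Or.inl hz))
    unfold Complex.sqrt
    rw [← one_div, mul_cpow_of_arg_add_mem Complex.I_ne_zero (Complex.ne_zero_of_re_pos hz)]
    rw [Complex.arg_I]
    constructor <;> linarith [Real.pi_pos]
  have hsqrt_I : Complex.sqrt I ≠ 0 := by
    simp only [Complex.sqrt, ne_eq, Complex.cpow_eq_zero_iff, Complex.I_ne_zero, false_and,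
      not_false_eq_true]
  have hS := ModularForm.eta_comp_eq_csqrt_I_inv (x := I * (b / (2 * π)))
    (by simpa [UpperHalfPlane.upperHalfPlaneSet] using hz)
  simp only [Function.comp_apply, Pi.smul_apply, Pi.mul_apply, smul_eq_mul] at hS
  have hdual : I * (4 * π ^ 2 / b) / (2 * π) = -1 / (I * (b / (2 * π))) := by
    have hpi : (π : ℂ) ≠ 0 := by exact_mod_cast Real.pi_ne_zero
    field_simp
    rw [Complex.I_sq]
    norm_num
  rw [etaBeta, etaBeta, hdual, hS, hsqrt, mul_div_assoc]
  field_simp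

theorem etaBeta_mul_etaBeta {z w : ℂ} (hz : 0 < z.re) (hw : 0 < w.re) :
    etaBeta z * etaBeta w = (4 * (π : ℂ) ^ 2 / (z * w)) ^ (1 / 2 : ℂ) *
      (etaBeta (4 * π ^ 2 / z) * etaBeta (4 * π ^ 2 / w)) := by
  have hz₀ : (z / (2 * π)) ^ (1 / 2 : ℂ) ≠ 0 := by
    simp [Complex.cpow_eq_zero_iff, Complex.ne_zero_of_re_pos hz]
  have hw₀ : (w / (2 * π)) ^ (1 / 2 : ℂ) ≠ 0 := by
    simp [Complex.cpow_eq_zero_iff, Complex.ne_zero_of_re_pos hw]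
  rw [four_pi_sq_div_mul_cpow hz hw, etaBeta_four_pi_sq_div hz, etaBeta_four_pi_sq_div hw]
  field_simp

/-! ### Integrals along vertical lines -/

theorem div_one_add_le_one_sub_exp_neg {v : ℝ} (hv : 0 ≤ v) : v / (1 + v) ≤ 1 - Real.exp (-v) := by
  have h : Real.exp (-v) ≤ 1 / (1 + v) := by
    rw [Real.exp_neg, ← one_div]
    exact one_div_le_one_div_of_le (by linarith) (by linarith [Real.add_one_le_exp v])
  calc v / (1 + v) = 1 - 1 / (1 + v) := by
        field_simp
        ring
    _ ≤ 1 - Real.exp (-v) := by linarith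

theorem norm_one_sub_exp_neg_le_two {u : ℂ} (hu : 0 ≤ u.re) : ‖1 - Complex.exp (-u)‖ ≤ 2 := by
  have h : ‖Complex.exp (-u)‖ ≤ 1 := by
    rw [Complex.norm_exp]
    exact Real.exp_le_one_iff.2 (by simpa using hu)
  calc ‖1 - Complex.exp (-u)‖ ≤ ‖(1 : ℂ)‖ + ‖Complex.exp (-u)‖ := norm_sub_le _ _
    _ ≤ 2 := by
      rw [norm_one]
      linarith

theorem norm_one_sub_exp_neg_le_two_mul {u : ℂ} (hu : 0 ≤ u.re) :
    ‖1 - Complex.exp (-u)‖ ≤ 2 * ‖u‖ := by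
  rcases le_total ‖u‖ 1 with h | h
  · rw [norm_sub_rev]
    simpa using Complex.norm_exp_sub_one_le (x := -u) (by simpa using h)
  · linarith [norm_one_sub_exp_neg_le_two hu]

theorem integrable_vertical {q : ℂ → ℂ} {β C r : ℝ} (hr : 1 < r)
    (hc : Continuous fun s : ℝ => q (β + s * I))
    (hq : ∀ s : ℝ, ‖q (β + s * I)‖ ≤ C * (1 + ‖(β + s * I : ℂ)‖) ^ (-r)) :
    Integrable fun s : ℝ => q (β + s * I) := by
  have hC : 0 ≤ C := nonneg_of_mul_nonneg_left ((norm_nonneg _).trans (hq 0)) (by positivity)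
  refine Integrable.mono' ((integrable_one_add_norm (by simpa using hr)).const_mul C)
    hc.aestronglyMeasurable (.of_forall fun s => (hq s).trans ?_)
  have him : ‖s‖ ≤ ‖(β + s * I : ℂ)‖ := by
    simpa using Complex.abs_im_le_norm (β + s * I : ℂ)
  gcongr C * ?_
  exact Real.rpow_le_rpow_of_nonpos (by positivity) (by linarith) (by linarith)

theorem norm_integral_vertical_segment_le {q : ℂ → ℂ} {β T M : ℝ} (hβT : |β| ≤ T)
    (hd : ∀ w : ℂ, β ≤ w.re → DifferentiableAt ℂ q w)
    (hM : ∀ w : ℂ, β ≤ w.re → T ≤ ‖w‖ → ‖q w‖ ≤ M) :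
    ‖∫ s in (-T)..T, q (β + s * I)‖ ≤ 6 * T * M := by
  obtain ⟨hβ₁, hβ₂⟩ := abs_le.1 hβT
  have hT : 0 ≤ T := (abs_nonneg β).trans hβT
  have hM₀ : 0 ≤ M := (norm_nonneg _).trans (hM T (by simpa) (by simpa using le_abs_self T))
  have hrect := Complex.integral_boundary_rect_eq_zero_of_differentiableOn q ⟨β, -T⟩ ⟨T, T⟩
    fun w hw => (hd w (by
      have := hw.1
      rw [mem_preimage, uIcc_of_le hβ₂] at this
      exact this.1)).differentiableWithinAt
  have hhor : ∀ y : ℝ, |y| = T → ‖∫ x in β..T, q (x + y * I)‖ ≤ M * |T - β| := fun y hy => by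
    refine intervalIntegral.norm_integral_le_of_norm_le_const fun x hx => hM _ ?_ ?_
    · rw [uIoc_of_le hβ₂] at hx
      simpa using hx.1.le
    · simpa [hy] using Complex.abs_im_le_norm (x + y * I : ℂ)
  have hright : ‖∫ y in (-T)..T, q (T + y * I)‖ ≤ M * |T - -T| := by
    refine intervalIntegral.norm_integral_le_of_norm_le_const fun y _ => hM _ (by simpa) ?_
    simpa [abs_of_nonneg hT] using Complex.abs_re_le_norm (T + y * I : ℂ)
  have hbot := hhor (-T) (by rw [abs_neg, abs_of_nonneg hT])
  have htop := hhor T (abs_of_nonneg hT)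
  rw [abs_of_nonneg (by linarith)] at hbot htop hright
  calc ‖∫ s in (-T)..T, q (β + s * I)‖ = ‖I • ∫ s in (-T)..T, q (β + s * I)‖ := by
        rw [norm_smul, Complex.norm_I, one_mul]
    _ = ‖(∫ x in β..T, q (x + ((-T : ℝ) : ℂ) * I)) - (∫ x in β..T, q (x + T * I)) +
          I • ∫ y in (-T)..T, q (T + y * I)‖ := by rw [sub_eq_zero.1 hrect]
    _ ≤ M * (T - β) + M * (T - β) + M * (T - -T) := by
        refine (norm_add_le _ _).trans (add_le_add ((norm_sub_le _ _).trans
          (add_le_add hbot htop)) ?_)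
        rwa [norm_smul, Complex.norm_I, one_mul]
    _ ≤ 6 * T * M := by nlinarith

theorem integral_vertical_eq_zero {q : ℂ → ℂ} {β C r : ℝ} (hr : 1 < r)
    (hd : ∀ w : ℂ, β ≤ w.re → DifferentiableAt ℂ q w)
    (hq : ∀ w : ℂ, β ≤ w.re → ‖q w‖ ≤ C * (1 + ‖w‖) ^ (-r)) :
    ∫ s : ℝ, q (β + s * I) = 0 := by
  have hre : ∀ s : ℝ, β ≤ (β + s * I : ℂ).re := fun s => by simp
  have hcont : Continuous fun s : ℝ => q (β + s * I) := continuous_iff_continuousAt.2 fun s =>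
    (hd _ (hre s)).continuousAt.comp (f := fun s : ℝ => (β + s * I : ℂ)) (by fun_prop)
  have hint := integrable_vertical hr hcont fun s => hq _ (hre s)
  have hC : 0 ≤ C :=
    nonneg_of_mul_nonneg_left ((norm_nonneg _).trans (hq β (by simp))) (by positivity)
  have hlim := intervalIntegral_tendsto_integral hint
    (tendsto_neg_atTop_atBot.comp tendsto_id) tendsto_id
  refine tendsto_nhds_unique hlim (squeeze_zero_norm' (a := fun T => 6 * C * T ^ (-(r - 1))) ?_ ?_)
  · filter_upwards [eventually_gt_atTop 0, eventually_ge_atTop |β|] with T hT hβT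
    have hdecay : ∀ w : ℂ, β ≤ w.re → T ≤ ‖w‖ → ‖q w‖ ≤ C * T ^ (-r) := fun w hw hTw => by
      refine (hq w hw).trans ?_
      gcongr C * ?_
      exact Real.rpow_le_rpow_of_nonpos hT (by linarith) (by linarith)
    calc _ ≤ 6 * T * (C * T ^ (-r)) := norm_integral_vertical_segment_le hβT hd hdecay
      _ = 6 * C * T ^ (-(r - 1)) := by
        rw [neg_sub, sub_eq_add_neg, Real.rpow_add hT, Real.rpow_one]
        ring
  · simpa using (tendsto_rpow_neg_atTop (sub_pos.2 hr)).const_mul (6 * C)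

/-! ### Laplace transforms of test functions -/

/-- The two-sided Laplace transform `(2π)⁻¹ ∫ g(h) e^{wh} dh` of a test function, normalised so that
integrating it against `e^{-wh} ds` along a vertical line `w = β + is` recovers `g(h)`. -/
def testTransform (g : ℝ → ℂ) (w : ℂ) : ℂ :=
  (1 / (2 * π) : ℂ) * ∫ h : ℝ, g h * Complex.exp (w * h)

theorem norm_exp_vertical_mul (β s h : ℝ) :
    ‖Complex.exp ((β + s * I) * h)‖ = Real.exp (β * h) := by
  simp [Complex.norm_exp]

theorem integrable_norm_mul_exp {g : ℝ → ℂ} (hg : Continuous g) (hc : HasCompactSupport g)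
    {f : ℝ → ℝ} (hf : Continuous f) : Integrable fun h : ℝ => ‖g h‖ * Real.exp (f h) :=
  Continuous.integrable_of_hasCompactSupport (by fun_prop) hc.norm.mul_right

theorem continuous_testTransform_vertical {g : ℝ → ℂ} (hg : Continuous g)
    (hc : HasCompactSupport g) (β : ℝ) :
    Continuous fun s : ℝ => testTransform g (β + s * I) := by
  unfold testTransform
  refine continuous_const.mul (continuous_of_dominated
    (bound := fun h : ℝ => ‖g h‖ * Real.exp (β * h)) (fun s => by fun_prop)
    (fun s => .of_forall fun h => ?_) (integrable_norm_mul_exp hg hc (by fun_prop))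
    (.of_forall fun h => by fun_prop))
  rw [norm_mul, norm_exp_vertical_mul]

theorem mul_testTransform {g : ℝ → ℂ} (hg : ContDiff ℝ 1 g) (hc : HasCompactSupport g) (w : ℂ) :
    w * testTransform g w = -testTransform (deriv g) w := by
  have hexp : ∀ x : ℝ, HasDerivAt (fun x : ℝ => Complex.exp (w * x)) (w * Complex.exp (w * x)) x :=
    fun x => by
      have h : HasDerivAt (fun x : ℝ => w * (x : ℂ)) w x := by
        simpa using (Complex.ofRealCLM.hasDerivAt (x := x)).const_mul w
      simpa only [mul_comm] using h.cexp
  have := hg.continuous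
  have := hg.continuous_deriv le_rfl
  have hparts := integral_mul_deriv_eq_deriv_mul_of_integrable
    (fun x _ => ((hg.differentiable one_ne_zero) x).hasDerivAt) (fun x _ => hexp x)
    (Continuous.integrable_of_hasCompactSupport (by fun_prop) hc.mul_right)
    (Continuous.integrable_of_hasCompactSupport (by fun_prop) hc.deriv.mul_right)
    (Continuous.integrable_of_hasCompactSupport (by fun_prop) hc.mul_right)
  have hlin : ∫ x : ℝ, g x * (w * Complex.exp (w * x)) =
      w * ∫ x : ℝ, g x * Complex.exp (w * x) := by
    rw [← integral_const_mul]
    exact integral_congr_ae (.of_forall fun x => by ring)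
  rw [testTransform, testTransform, mul_left_comm, ← hlin, hparts, mul_neg]

theorem exists_norm_testTransform_le {g : ℝ → ℂ} (hg : ContDiff ℝ ∞ g) (hc : HasCompactSupport g)
    (B : ℝ) (N : ℕ) :
    ∃ C, 0 ≤ C ∧ ∀ w : ℂ, |w.re| ≤ B → ‖w‖ ^ N * ‖testTransform g w‖ ≤ C := by
  induction N generalizing g with
  | zero =>
    refine ⟨‖(1 / (2 * π) : ℂ)‖ * ∫ h, ‖g h‖ * Real.exp (B * |h|), by positivity, fun w hw => ?_⟩
    rw [pow_zero, one_mul, testTransform, norm_mul]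
    gcongr
    refine norm_integral_le_of_norm_le (integrable_norm_mul_exp hg.continuous hc (by fun_prop))
      (.of_forall fun h => ?_)
    rw [norm_mul, Complex.norm_exp, Complex.re_mul_ofReal]
    gcongr ‖g h‖ * Real.exp ?_
    calc w.re * h ≤ |w.re| * |h| := by
          rw [← abs_mul]
          exact le_abs_self _
      _ ≤ B * |h| := by gcongr
  | succ N ih =>
    obtain ⟨C, hC, hbound⟩ := ih (contDiff_infty_iff_deriv.1 hg).2 hc.deriv
    refine ⟨C, hC, fun w hw => ?_⟩
    have hparts := congrArg norm (mul_testTransform (hg.of_le (mod_cast le_top)) hc w)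
    rw [norm_mul, norm_neg] at hparts
    rw [pow_succ, mul_assoc, hparts]
    exact hbound w hw

theorem integrable_testTransform_vertical {g : ℝ → ℂ} (hg : ContDiff ℝ ∞ g)
    (hc : HasCompactSupport g) (β : ℝ) : Integrable fun s : ℝ => testTransform g (β + s * I) := by
  obtain ⟨C₀, -, h₀⟩ := exists_norm_testTransform_le hg hc |β| 0
  obtain ⟨C₂, -, h₂⟩ := exists_norm_testTransform_le hg hc |β| 2
  refine (integrable_inv_one_add_sq.const_mul (C₀ + C₂)).mono'
    (continuous_testTransform_vertical hg.continuous hc β).aestronglyMeasurable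
    (.of_forall fun s => ?_)
  have hre : |(β + s * I : ℂ).re| ≤ |β| := by simp
  have him : s ^ 2 ≤ ‖(β + s * I : ℂ)‖ ^ 2 := by
    rw [← sq_abs s]
    gcongr
    simpa using Complex.abs_im_le_norm (β + s * I : ℂ)
  rw [← div_eq_mul_inv, le_div_iff₀ (by positivity)]
  calc ‖testTransform g (β + s * I)‖ * (1 + s ^ 2)
      ≤ ‖testTransform g (β + s * I)‖ * (1 + ‖(β + s * I : ℂ)‖ ^ 2) := by gcongr
    _ = ‖(β + s * I : ℂ)‖ ^ 0 * ‖testTransform g (β + s * I)‖ +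
        ‖(β + s * I : ℂ)‖ ^ 2 * ‖testTransform g (β + s * I)‖ := by ring
    _ ≤ C₀ + C₂ := add_le_add (h₀ _ hre) (h₂ _ hre)

theorem fourier_mul_exp (g : ℝ → ℂ) (β ξ : ℝ) :
    𝓕 (fun x : ℝ => g x * Complex.exp (β * x)) ξ =
      2 * π * testTransform g (β + ((-(2 * π) * ξ : ℝ) : ℂ) * I) := by
  have hpi : (π : ℂ) ≠ 0 := by exact_mod_cast Real.pi_ne_zero
  rw [Real.fourier_real_eq_integral_exp_smul, testTransform, ← mul_assoc,
    mul_one_div_cancel (by simp [hpi]), one_mul]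
  refine integral_congr_ae (.of_forall fun x => ?_)
  dsimp only
  rw [smul_eq_mul, mul_left_comm, ← Complex.exp_add]
  congr 2
  push_cast
  ring

theorem eq_integral_testTransform_mul_exp {g : ℝ → ℂ} (hg : ContDiff ℝ ∞ g)
    (hc : HasCompactSupport g) (β h : ℝ) :
    g h = ∫ s : ℝ, testTransform g (β + s * I) * Complex.exp (-(h : ℂ) * (β + s * I)) := by
  set f : ℝ → ℂ := fun x => g x * Complex.exp (β * x)
  set q : ℝ → ℂ := fun s => testTransform g (β + s * I) * Complex.exp (-(h : ℂ) * (s * I))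
  have hgc := hg.continuous
  have hfc : Continuous f := by fun_prop
  have hfi : Integrable f := hfc.integrable_of_hasCompactSupport hc.mul_right
  have hFi : Integrable (𝓕 f) := by
    rw [funext (fourier_mul_exp g β)]
    exact ((integrable_testTransform_vertical hg hc β).comp_mul_left'
      (R := -(2 * π)) (by simp)).const_mul _
  have hfourier : f h = ∫ ξ : ℝ, 2 * π * q (-(2 * π) * ξ) := by
    rw [← congrFun (hfc.fourierInv_fourier_eq hfi hFi) h, Real.fourierInv_eq']
    refine integral_congr_ae (.of_forall fun ξ => ?_)
    dsimp only [q]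
    have hexp : Complex.exp (((2 * π * inner ℝ ξ h : ℝ) : ℂ) * I) =
        Complex.exp (-(h : ℂ) * (((-(2 * π) * ξ : ℝ) : ℂ) * I)) := by
      congr 1
      simp only [RCLike.inner_apply, conj_trivial]
      push_cast
      ring
    rw [fourier_mul_exp, smul_eq_mul, hexp]
    ring
  have hsubst : f h = ∫ s, q s := by
    rw [hfourier, integral_const_mul, Measure.integral_comp_mul_left q, Complex.real_smul,
      ← mul_assoc, inv_neg, abs_neg, abs_of_pos (by positivity)]
    push_cast
    rw [mul_inv_cancel₀ (by simp), one_mul]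
  calc g h = Complex.exp (-(h : ℂ) * β) * f h := by
        rw [mul_left_comm, ← Complex.exp_add]
        ring_nf
        simp
    _ = _ := by
        rw [hsubst, ← integral_const_mul]
        refine integral_congr_ae (.of_forall fun s => ?_)
        dsimp only [q]
        rw [mul_left_comm, ← Complex.exp_add]
        ring_nf

theorem integral_eq_integral_testTransform_mul {μ : Measure ℝ} [SFinite μ] {β : ℝ}
    (hμ : Integrable (fun h : ℝ => Real.exp (-h * β)) μ) {g : ℝ → ℂ} (hg : ContDiff ℝ ∞ g)
    (hc : HasCompactSupport g) :
    ∫ h, g h ∂μ = ∫ s : ℝ, testTransform g (β + s * I) *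
      ∫ h, Complex.exp (-(h : ℂ) * (β + s * I)) ∂μ := by
  have hint : Integrable (Function.uncurry fun h s : ℝ => testTransform g (β + s * I) *
      Complex.exp (-(h : ℂ) * (β + s * I))) (μ.prod volume) := by
    refine (hμ.mul_prod (integrable_testTransform_vertical hg hc β).norm).mono' ?_
      (.of_forall fun p => ?_)
    · have := (continuous_testTransform_vertical hg.continuous hc β).comp
        (continuous_snd (X := ℝ) (Y := ℝ))
      exact Continuous.aestronglyMeasurable (this.mul (by fun_prop))
    · simp only [Function.uncurry, norm_mul, Complex.norm_exp]
      simp [mul_comm]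
  rw [integral_congr_ae (.of_forall fun h => eq_integral_testTransform_mul_exp hg hc β h),
    integral_integral_swap hint]
  simp_rw [integral_const_mul]

theorem integral_mul_integral_exp {F : ℝ → ℂ} (hF : Integrable F) {g : ℝ → ℂ} (hg : Continuous g)
    (hc : HasCompactSupport g) (β : ℝ) :
    ∫ h : ℝ, g h * ((1 / (2 * π) : ℂ) * ∫ s : ℝ, F s * Complex.exp ((β + s * I) * h)) =
      ∫ s : ℝ, testTransform g (β + s * I) * F s := by
  have hint : Integrable (Function.uncurry fun h s : ℝ => g h * (F s *
      Complex.exp ((β + s * I) * h))) ((volume : Measure ℝ).prod volume) := by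
    refine ((integrable_norm_mul_exp hg hc (f := fun h => β * h) (by fun_prop)).mul_prod
      hF.norm).mono' ?_ (.of_forall fun p => ?_)
    · have hF' := hF.aestronglyMeasurable.comp_snd (μ := (volume : Measure ℝ))
      exact (hg.comp continuous_fst).aestronglyMeasurable.mul
        (hF'.mul (Continuous.aestronglyMeasurable (by fun_prop)))
    · simp only [Function.uncurry, norm_mul, norm_exp_vertical_mul]
      exact le_of_eq (by ring)
  calc _ = (1 / (2 * π) : ℂ) * ∫ h : ℝ, ∫ s : ℝ, g h * (F s *
          Complex.exp ((β + s * I) * h)) := by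
        simp_rw [integral_const_mul, mul_left_comm (g _), integral_const_mul]
    _ = (1 / (2 * π) : ℂ) * ∫ s : ℝ, F s * ∫ h : ℝ, g h * Complex.exp ((β + s * I) * h) := by
        rw [integral_integral_swap hint]
        simp_rw [mul_left_comm (g _), integral_const_mul]
    _ = _ := by
        simp_rw [testTransform, mul_assoc, integral_const_mul, mul_comm (F _)]

section Rescale

variable {φ : ℝ → ℂ}

theorem contDiff_rescale (hφ : ContDiff ℝ ∞ φ) (hstar lam : ℝ) :
    ContDiff ℝ ∞ (rescale φ hstar lam) := by
  unfold rescale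
  fun_prop

theorem hasCompactSupport_rescale (hs : HasCompactSupport φ) (hstar : ℝ) {lam : ℝ}
    (hlam : lam ≠ 0) : HasCompactSupport (rescale φ hstar lam) := by
  have h := hs.comp_homeomorph
    ((Homeomorph.subRight hstar).trans (Homeomorph.mulRight₀ lam⁻¹ (inv_ne_zero hlam)))
  unfold rescale
  simp_rw [div_eq_mul_inv]
  exact h.mul_left

theorem testTransform_rescale (φ : ℝ → ℂ) (hstar : ℝ) {lam : ℝ} (hlam : 0 < lam) (w : ℂ) :
    testTransform (rescale φ hstar lam) w =
      Complex.exp (w * hstar) * testTransform φ (lam * w) := by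
  have hl : (lam : ℂ) ≠ 0 := by exact_mod_cast hlam.ne'
  set F : ℝ → ℂ := fun x => (lam : ℂ)⁻¹ * (Complex.exp (w * hstar) *
    (φ x * Complex.exp (lam * w * x)))
  have hF : ∀ h : ℝ, rescale φ hstar lam (h + hstar) * Complex.exp (w * ((h + hstar : ℝ) : ℂ)) =
      F (h / lam) := fun h => by
    have he : Complex.exp (w * ((h + hstar : ℝ) : ℂ)) =
        Complex.exp (w * hstar) * Complex.exp (lam * w * ((h / lam : ℝ) : ℂ)) := by
      rw [← Complex.exp_add]
      congr 1
      push_cast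
      field_simp
      ring
    simp only [rescale, F, he, add_sub_cancel_right]
    ring
  rw [testTransform, ← integral_add_right_eq_self _ hstar]
  simp_rw [hF]
  rw [Measure.integral_comp_div F, abs_of_pos hlam, Complex.real_smul, integral_const_mul,
    integral_const_mul, mul_inv_cancel_left₀ hl, testTransform]
  ring

theorem exists_norm_testTransform_rescale_le (hφ : ContDiff ℝ ∞ φ) (hs : HasCompactSupport φ)
    {β : ℝ} (hβ : 0 < β) (Λ b : ℝ) (N : ℕ) : ∃ C, 0 ≤ C ∧
    ∀ lam hstar s : ℝ, 0 < lam → lam ≤ Λ → hstar ≤ b →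
      ‖testTransform (rescale φ hstar lam) (β + s * I)‖ ≤
        C * ((lam * ‖(β + s * I : ℂ)‖) ^ N)⁻¹ := by
  obtain ⟨C, hC, hbound⟩ := exists_norm_testTransform_le hφ hs (Λ * β) N
  refine ⟨Real.exp (β * b) * C, by positivity, fun lam hstar s hlam hΛ hb => ?_⟩
  have hw : 0 < ‖(β + s * I : ℂ)‖ :=
    norm_pos_iff.2 (Complex.ne_zero_of_re_pos (by simpa using hβ))
  have h := hbound (lam * (β + s * I)) (by
    simp only [Complex.re_ofReal_mul, Complex.add_re, Complex.ofReal_re, Complex.re_ofReal_mul,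
      Complex.I_re, mul_zero, add_zero]
    rw [abs_of_pos (by positivity)]
    gcongr)
  rw [norm_mul, Complex.norm_real, Real.norm_of_nonneg hlam.le] at h
  rw [testTransform_rescale _ _ hlam, norm_mul, norm_exp_vertical_mul, mul_assoc]
  gcongr
  rwa [← div_eq_mul_inv, le_div_iff₀' (by positivity)]

theorem sq_norm_vertical (β s : ℝ) : ‖(β + s * I : ℂ)‖ ^ 2 = β ^ 2 + s ^ 2 := by
  rw [Complex.sq_norm, Complex.normSq_add_mul_I]

theorem integrable_inv_sq_norm_vertical {β : ℝ} (hβ : β ≠ 0) :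
    Integrable fun s : ℝ => (‖(β + s * I : ℂ)‖ ^ 2)⁻¹ := by
  refine ((integrable_inv_one_add_sq.comp_div hβ).const_mul (β ^ 2)⁻¹).congr
    (.of_forall fun s => ?_)
  simp only [sq_norm_vertical]
  rw [← mul_inv]
  field_simp

end Rescale

/-! ### The partition function and its Fourier modes -/

theorem integral_exp_vertical_mul_int (α : ℝ) (n : ℤ) :
    ∫ t in (-π)..π, Complex.exp ((α + t * I) * n) = if n = 0 then 2 * (π : ℂ) else 0 := by
  split_ifs with hn
  · subst hn
    simp [two_mul]
  · have hc : (n : ℂ) * I ≠ 0 := mul_ne_zero (Int.cast_ne_zero.2 hn) Complex.I_ne_zero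
    have hsplit : ∀ t : ℝ, Complex.exp ((α + t * I) * n) =
        Complex.exp (α * n) * Complex.exp (n * I * t) := fun t => by
      rw [← Complex.exp_add]
      ring_nf
    have hperiod : Complex.exp (n * I * (π : ℝ)) = Complex.exp (n * I * ((-π : ℝ) : ℂ)) := by
      rw [Complex.exp_eq_exp_iff_exists_int]
      refine ⟨n, ?_⟩
      push_cast
      ring
    simp_rw [hsplit]
    rw [intervalIntegral.integral_const_mul, integral_exp_mul_complex hc, hperiod, sub_self,
      zero_div, mul_zero]

theorem integral_exp_vertical_mul_of_hasSum {α : ℝ} {c : ℤ → ℂ} {f : ℝ → ℂ}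
    (hf : ∀ t : ℝ, HasSum (fun K : ℤ => Complex.exp (-K * (α + t * I)) * c K) (f t)) (J : ℤ) :
    ∫ t in (-π)..π, Complex.exp ((α + t * I) * J) * f t = 2 * π * c J := by
  set F : ℤ → ℝ → ℂ := fun K t => Complex.exp ((α + t * I) * ((J - K : ℤ) : ℂ)) * c K
  have hF : ∀ t, HasSum (F · t) (Complex.exp ((α + t * I) * J) * f t) := fun t => by
    refine ((hf t).mul_left _).congr_fun fun K => ?_
    simp only [F]
    rw [← mul_assoc, ← Complex.exp_add]
    push_cast
    ring_nf
  have hnorm : ∀ K t, ‖F K t‖ = ‖F K 0‖ := fun K t => by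
    simp [F, Complex.norm_exp]
  have hint := intervalIntegral.hasSum_integral_of_dominated_convergence (μ := volume)
    (a := -π) (b := π) (fun K _ => ‖F K 0‖) (fun K => Continuous.aestronglyMeasurable (by fun_prop))
    (fun K => .of_forall fun t _ => (hnorm K t).le) (.of_forall fun t _ => (hF 0).summable.norm)
    intervalIntegrable_const (.of_forall fun t _ => hF t)
  have hmode : (fun K => ∫ t in (-π)..π, F K t) = fun K => if K = J then 2 * π * c J else 0 := by
    ext K
    simp only [F]
    rw [intervalIntegral.integral_mul_const, integral_exp_vertical_mul_int]
    by_cases hK : K = J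
    · simp [hK]
    · rw [if_neg hK, if_neg (by omega), zero_mul]
  exact hint.unique (hmode ▸ hasSum_ite_eq J _)

theorem isFiniteMeasureOnCompacts_of_integrable {X : Type*} [TopologicalSpace X]
    [MeasurableSpace X] {μ : Measure X} {f : X → ℝ} (hf : Continuous f) (hpos : ∀ x, 0 < f x)
    (hi : Integrable f μ) : IsFiniteMeasureOnCompacts μ := by
  refine ⟨fun K hK => ?_⟩
  rcases K.eq_empty_or_nonempty with rfl | hne
  · simp
  obtain ⟨x₀, -, hmin⟩ := hK.exists_isMinOn hne hf.continuousOn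
  exact (measure_mono fun x hx => hmin hx).trans_lt (hi.measure_ge_lt_top (hpos x₀))

namespace CFTData

/-- The Laplace transform `∫ e^{-hw} ρ_J(J + 2h) dh` of the spin-`J` density. -/
def laplace (S : CFTData) (J : ℤ) (w : ℂ) : ℂ :=
  ∫ h, Complex.exp (-(h : ℂ) * w) ∂S.rhoH J

/-- The contribution of the non-identity primaries to `η(β_L) η(β_R) Z(β_L, β_R)`, without the
prefactor `e^{A (β_L + β_R)}`. -/
def primarySum (S : CFTData) (βL βR : ℂ) : ℂ :=
  ∫ x, Complex.exp (-(x.1 : ℂ) * βL - (x.2 : ℂ) * βR) ∂S.pairDensity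

/-- `CFTData.primarySum` at real arguments, as a real number. -/
def realPrimarySum (S : CFTData) (a b : ℝ) : ℝ :=
  ∫ x, Real.exp (-x.1 * a - x.2 * b) ∂S.pairDensity

/-- The partition function of the primaries, `η(β_L) η(β_R) Z(β_L, β_R)`. -/
def reducedZ (S : CFTData) (βL βR : ℂ) : ℂ :=
  Complex.exp (S.A * (βL + βR)) *
    ((1 - Complex.exp (-βL)) * (1 - Complex.exp (-βR)) + S.primarySum βL βR)

/-- `CFTData.reducedZ` at real arguments, as a real number. -/
def realReducedZ (S : CFTData) (a b : ℝ) : ℝ :=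
  Real.exp (S.A * (a + b)) *
    ((1 - Real.exp (-a)) * (1 - Real.exp (-b)) + S.realPrimarySum a b)

variable {S : CFTData}

theorem pairDensity_eq_sum_rhoH :
    S.pairDensity =
      Measure.sum fun J : ℤ => (2 : NNReal) • (S.rhoH J).map fun h : ℝ => (h, h + (J : ℝ)) := by
  rw [pairDensity]
  congr 1
  ext1 J
  rw [rhoH, Measure.map_smul, smul_smul, mul_inv_cancel₀ two_ne_zero, one_smul,
    Measure.map_map (by fun_prop) (by fun_prop)]
  congr 1
  ext1 Δ
  simp only [Function.comp_apply, Prod.mk.injEq, true_and]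
  ring

theorem norm_exp_pair (x : ℝ × ℝ) (βL βR : ℂ) :
    ‖Complex.exp (-(x.1 : ℂ) * βL - (x.2 : ℂ) * βR)‖ = Real.exp (-x.1 * βL.re - x.2 * βR.re) := by
  simp [Complex.norm_exp]

theorem norm_primarySum_le (βL βR : ℂ) :
    ‖S.primarySum βL βR‖ ≤ S.realPrimarySum βL.re βR.re := by
  refine (norm_integral_le_integral_norm _).trans_eq ?_
  simp_rw [norm_exp_pair]
  rfl

theorem reducedZ_ofReal (a b : ℝ) : S.reducedZ a b = S.realReducedZ a b := by
  have hsum : S.primarySum a b = S.realPrimarySum a b := by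
    rw [primarySum, realPrimarySum, ← integral_complex_ofReal]
    push_cast
    rfl
  rw [reducedZ, realReducedZ, hsum]
  push_cast
  rfl

theorem realPrimarySum_nonneg (a b : ℝ) : 0 ≤ S.realPrimarySum a b :=
  integral_nonneg fun _ => (Real.exp_pos _).le

theorem norm_laplace_le (J : ℤ) (w : ℂ) : ‖S.laplace J w‖ ≤ ‖S.laplace J w.re‖ := by
  have hre : S.laplace J w.re = ((∫ h, ‖Complex.exp (-(h : ℂ) * w)‖ ∂S.rhoH J : ℝ) : ℂ) := by
    rw [laplace, ← integral_complex_ofReal]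
    simp [Complex.norm_exp]
  rw [hre, Complex.norm_real, Real.norm_of_nonneg (by positivity)]
  exact norm_integral_le_integral_norm _

namespace IsModularCFT

theorem A_pos (hS : S.IsModularCFT) : 0 < S.A :=
  div_pos (sub_pos.2 hS.one_lt_c) (by norm_num)

theorem ae_rhoH (hS : S.IsModularCFT) (J : ℤ) :
    ∀ᵐ h ∂S.rhoH J, S.Tgap < h ∧ S.Tgap < h + J := by
  have hΔ : ∀ᵐ Δ ∂S.rho J, |(J : ℝ)| + 2 * S.Tgap < Δ := by
    filter_upwards [measure_eq_zero_iff_ae_notMem.1 (hS.twist_gap J)] with Δ h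
    simpa using h
  have hset : MeasurableSet {h : ℝ | S.Tgap < h ∧ S.Tgap < h + J} :=
    measurableSet_Ioi.inter
      (measurableSet_lt measurable_const (by fun_prop : Measurable fun h : ℝ => h + J))
  refine Measure.ae_smul_measure ((ae_map_iff (by fun_prop) hset).2 ?_) _
  filter_upwards [hΔ] with Δ h
  have := le_abs_self (J : ℝ)
  have := neg_le_abs (J : ℝ)
  constructor <;> linarith

theorem rhoH_restrict (hS : S.IsModularCFT) (J : ℤ) :
    (S.rhoH J).restrict (Ioi S.Tgap) = S.rhoH J :=
  Measure.restrict_eq_self_of_ae_mem ((hS.ae_rhoH J).mono fun _ h => h.1)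

theorem ae_pairDensity (hS : S.IsModularCFT) :
    ∀ᵐ x ∂S.pairDensity, x ∈ Ioi S.Tgap ×ˢ Ioi S.Tgap := by
  rw [pairDensity_eq_sum_rhoH, Measure.ae_sum_iff]
  exact fun J => Measure.ae_smul_measure ((ae_map_iff (by fun_prop)
    (measurableSet_Ioi.prod measurableSet_Ioi)).2 (hS.ae_rhoH J)) _

theorem integrable_real_exp_pair (hS : S.IsModularCFT) {a b : ℝ} (ha : 0 < a) (hb : 0 < b) :
    Integrable (fun x : ℝ × ℝ => Real.exp (-x.1 * a - x.2 * b)) S.pairDensity := by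
  refine ⟨by fun_prop, ?_⟩
  rw [hasFiniteIntegral_iff_ofReal (.of_forall fun _ => (Real.exp_pos _).le), lt_top_iff_ne_top]
  convert hS.convergent ((a + b) / 2) ((b - a) / 2)
    (by rw [abs_lt]; constructor <;> linarith) using 1
  rw [pairDensity, lintegral_sum_measure]
  congr 1
  ext1 J
  rw [lintegral_map (by fun_prop) (by fun_prop)]
  refine lintegral_congr fun Δ => ?_
  ring_nf

theorem integrable_exp_pair (hS : S.IsModularCFT) {βL βR : ℂ} (hL : 0 < βL.re) (hR : 0 < βR.re) :
    Integrable (fun x : ℝ × ℝ => Complex.exp (-(x.1 : ℂ) * βL - (x.2 : ℂ) * βR))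
      S.pairDensity :=
  (hS.integrable_real_exp_pair hL hR).mono' (by fun_prop)
    (.of_forall fun x => (norm_exp_pair x βL βR).le)

theorem integrable_exp_rhoH (hS : S.IsModularCFT) (J : ℤ) {w : ℝ} (hw : 0 < w) :
    Integrable (fun h : ℝ => Real.exp (-h * w)) (S.rhoH J) := by
  have h := hS.integrable_real_exp_pair (half_pos hw) (half_pos hw)
  rw [pairDensity_eq_sum_rhoH] at h
  have hJ := (h.mono_measure (Measure.le_sum _ J)).smul_measure_nnreal (c := 2⁻¹)
  rw [smul_smul, inv_mul_cancel₀ two_ne_zero, one_smul,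
    integrable_map_measure (by fun_prop) (by fun_prop)] at hJ
  refine (hJ.const_mul (Real.exp (J * (w / 2)))).congr (.of_forall fun h => ?_)
  simp only [Function.comp_apply]
  rw [← Real.exp_add]
  ring_nf

theorem isFiniteMeasureOnCompacts_rhoH (hS : S.IsModularCFT) (J : ℤ) :
    IsFiniteMeasureOnCompacts (S.rhoH J) :=
  isFiniteMeasureOnCompacts_of_integrable (by fun_prop) (fun _ => Real.exp_pos _)
    (hS.integrable_exp_rhoH J one_pos)

theorem continuous_laplace_vertical (hS : S.IsModularCFT) (J : ℤ) {β : ℝ} (hβ : 0 < β) :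
    Continuous fun s : ℝ => S.laplace J (β + s * I) := by
  refine continuous_of_dominated (bound := fun h : ℝ => Real.exp (-h * β)) (fun s => by fun_prop)
    (fun s => .of_forall fun h => ?_) (hS.integrable_exp_rhoH J hβ)
    (.of_forall fun h => by fun_prop)
  simp [Complex.norm_exp]

theorem realPrimarySum_le_exp_mul (hS : S.IsModularCFT) {a a' b b' : ℝ} (ha : 0 < a)
    (haa : a ≤ a') (hb : 0 < b) (hbb : b ≤ b') :
    S.realPrimarySum a' b' ≤
      Real.exp (-S.Tgap * (a' - a) - S.Tgap * (b' - b)) * S.realPrimarySum a b := by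
  rw [realPrimarySum, realPrimarySum, ← integral_const_mul]
  refine integral_mono_ae (hS.integrable_real_exp_pair (ha.trans_le haa) (hb.trans_le hbb))
    ((hS.integrable_real_exp_pair ha hb).const_mul _) ?_
  filter_upwards [hS.ae_pairDensity] with x hx
  have h₁ := mul_le_mul_of_nonneg_right (mem_Ioi.1 hx.1).le (sub_nonneg.2 haa)
  have h₂ := mul_le_mul_of_nonneg_right (mem_Ioi.1 hx.2).le (sub_nonneg.2 hbb)
  rw [← Real.exp_add]
  gcongr
  linarith

theorem realPrimarySum_antitone (hS : S.IsModularCFT) {a a' b b' : ℝ} (ha : 0 < a)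
    (haa : a ≤ a') (hb : 0 < b) (hbb : b ≤ b') :
    S.realPrimarySum a' b' ≤ S.realPrimarySum a b := by
  refine (hS.realPrimarySum_le_exp_mul ha haa hb hbb).trans
    (mul_le_of_le_one_left (realPrimarySum_nonneg a b) (Real.exp_le_one_iff.2 ?_))
  have h₁ := mul_nonneg hS.Tgap_pos.le (sub_nonneg.2 haa)
  have h₂ := mul_nonneg hS.Tgap_pos.le (sub_nonneg.2 hbb)
  linarith

theorem Z_eq_reducedZ_div (hS : S.IsModularCFT) (βL βR : ℂ) :
    S.Z βL βR = S.reducedZ βL βR / (etaBeta βL * etaBeta βR) := by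
  rw [Z, Measure.restrict_eq_self_of_ae_mem hS.ae_pairDensity, reducedZ, primarySum,
    div_mul_eq_mul_div]

theorem reducedZ_inversion (hS : S.IsModularCFT) {βL βR : ℂ} (hL : 0 < βL.re) (hR : 0 < βR.re) :
    S.reducedZ βL βR = (4 * π ^ 2 / (βL * βR)) ^ (1 / 2 : ℂ) *
      S.reducedZ (4 * π ^ 2 / βL) (4 * π ^ 2 / βR) := by
  have hη : etaBeta βL * etaBeta βR ≠ 0 := mul_ne_zero (etaBeta_ne_zero hL) (etaBeta_ne_zero hR)
  have hη' : etaBeta (4 * π ^ 2 / βL) * etaBeta (4 * π ^ 2 / βR) ≠ 0 :=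
    mul_ne_zero (etaBeta_ne_zero (re_four_pi_sq_div_pos hL))
      (etaBeta_ne_zero (re_four_pi_sq_div_pos hR))
  have hZ := hS.modular_S βL βR hL hR
  rw [hS.Z_eq_reducedZ_div, hS.Z_eq_reducedZ_div, div_eq_div_iff hη' hη] at hZ
  refine mul_right_cancel₀ hη' ?_
  rw [← hZ, etaBeta_mul_etaBeta hL hR]
  ring

theorem realReducedZ_inversion (hS : S.IsModularCFT) {a b : ℝ} (ha : 0 < a) (hb : 0 < b) :
    S.realReducedZ a b = √(4 * π ^ 2 / (a * b)) *
      S.realReducedZ (4 * π ^ 2 / a) (4 * π ^ 2 / b) := by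
  have h := hS.reducedZ_inversion (βL := a) (βR := b) (by simpa) (by simpa)
  rw [Real.sqrt_eq_rpow]
  apply Complex.ofReal_injective
  rw [Complex.ofReal_mul, Complex.ofReal_cpow (by positivity)]
  simp only [← reducedZ_ofReal]
  push_cast
  exact h

theorem hasSum_primarySum (hS : S.IsModularCFT) {βL βR : ℂ} (hL : 0 < βL.re) (hR : 0 < βR.re) :
    HasSum (fun J : ℤ => Complex.exp (-J * βR) * (2 * S.laplace J (βL + βR)))
      (S.primarySum βL βR) := by
  have hint := hS.integrable_exp_pair hL hR
  rw [primarySum]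
  rw [pairDensity_eq_sum_rhoH] at hint ⊢
  refine (hasSum_integral_measure hint).congr_fun fun J => ?_
  rw [integral_smul_nnreal_measure, integral_map (by fun_prop) (by fun_prop), NNReal.smul_def,
    Complex.real_smul, laplace, mul_left_comm, ← integral_const_mul]
  simp_rw [← Complex.exp_add]
  push_cast
  congr 2
  ext1 h
  ring_nf

theorem hasSum_reducedZ (hS : S.IsModularCFT) {βL z : ℂ} (hz : 0 < z.re) (hw : z.re < βL.re) :
    HasSum (fun J : ℤ => Complex.exp (-J * z) * (Complex.exp (S.A * βL) *
      ((Pi.single (M := fun _ => ℂ) 0 (1 + Complex.exp (-βL)) J -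
        Pi.single (M := fun _ => ℂ) 1 1 J -
        Pi.single (M := fun _ => ℂ) (-1) (Complex.exp (-βL)) J) + 2 * S.laplace J βL)))
      (S.reducedZ (βL - z) z) := by
  have hsingle : ∀ (K : ℤ) (x : ℂ), HasSum (fun J : ℤ => Complex.exp (-J * z) *
      Pi.single (M := fun _ => ℂ) K x J) (Complex.exp (-K * z) * x) := fun K x => by
    convert hasSum_single K fun J hJ => ?_ using 1
    · rw [Pi.single_eq_same]
    · rw [Pi.single_eq_of_ne hJ, mul_zero]
  have hvac : (1 - Complex.exp (-(βL - z))) * (1 - Complex.exp (-z)) =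
      Complex.exp (-(0 : ℤ) * z) * (1 + Complex.exp (-βL)) - Complex.exp (-(1 : ℤ) * z) * 1 -
        Complex.exp (-(-1 : ℤ) * z) * Complex.exp (-βL) := by
    have hsplit : Complex.exp (-(βL - z)) = Complex.exp z * Complex.exp (-βL) := by
      rw [← Complex.exp_add]
      ring_nf
    have hinv : Complex.exp z * Complex.exp (-z) = 1 := by rw [← Complex.exp_add]; simp
    simp only [Int.cast_zero, Int.cast_one, Int.cast_neg, neg_zero, neg_neg, zero_mul, one_mul,
      neg_mul, Complex.exp_zero, hsplit]
    linear_combination Complex.exp (-βL) * hinv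
  have hprim := hS.hasSum_primarySum (βL := βL - z) (by simpa using hw) hz
  have h := ((((hsingle 0 (1 + Complex.exp (-βL))).sub (hsingle 1 1)).sub
    (hsingle (-1) (Complex.exp (-βL)))).add hprim).mul_left (Complex.exp (S.A * βL))
  rw [← hvac] at h
  rw [reducedZ, sub_add_cancel]
  refine h.congr_fun fun J => ?_
  rw [sub_add_cancel]
  ring

theorem integral_exp_mul_reducedZ (hS : S.IsModularCFT) {α : ℝ} (hα : 0 < α) {βL : ℂ}
    (hβ : α < βL.re) {J : ℤ} (hJ : 2 ≤ J) :
    ∫ t in (-π)..π, Complex.exp ((α + t * I) * J) * S.reducedZ (βL - (α + t * I)) (α + t * I) =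
      2 * π * (Complex.exp (S.A * βL) * (2 * S.laplace J βL)) := by
  have hsum := fun t : ℝ => hS.hasSum_reducedZ (βL := βL) (z := α + t * I)
    (by simpa using hα) (by simpa using hβ)
  rw [integral_exp_vertical_mul_of_hasSum hsum, Pi.single_eq_of_ne (by omega),
    Pi.single_eq_of_ne (by omega), Pi.single_eq_of_ne (by omega), sub_zero, sub_zero, zero_add]

theorem continuous_reducedZ_segment (hS : S.IsModularCFT) {α : ℝ} (hα : 0 < α) {βL : ℂ}
    (hβ : α < βL.re) :
    Continuous fun t : ℝ => S.reducedZ (βL - (α + t * I)) (α + t * I) := by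
  have hprim : Continuous fun t : ℝ => S.primarySum (βL - (α + t * I)) (α + t * I) := by
    refine continuous_of_dominated (bound := fun x : ℝ × ℝ =>
      Real.exp (-x.1 * (βL.re - α) - x.2 * α)) (fun t => by fun_prop)
      (fun t => .of_forall fun x => ?_)
      (hS.integrable_real_exp_pair (sub_pos.2 hβ) hα) (.of_forall fun x => by fun_prop)
    rw [norm_exp_pair]
    simp
  unfold reducedZ
  fun_prop

end IsModularCFT

end CFTData

/-! ### Growth of the sum over primaries -/

theorem one_sub_exp_neg_nonneg {x : ℝ} (hx : 0 ≤ x) : 0 ≤ 1 - Real.exp (-x) := by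
  simpa

theorem sqrt_le_exp {x : ℝ} (hx : 0 ≤ x) : √x ≤ Real.exp x :=
  (Real.sqrt_le_iff.2 ⟨by linarith, by nlinarith⟩).trans (Real.add_one_le_exp x)

theorem two_pi_le_four_pi_sq_div {a : ℝ} (ha : 0 < a) (ha' : a ≤ 2 * π) :
    2 * π ≤ 4 * π ^ 2 / a := by
  rw [le_div_iff₀ ha]
  nlinarith [Real.pi_pos]

theorem four_pi_sq_mul_div_add_sq_le {α : ℝ} (hα : 0 < α) (t : ℝ) :
    4 * π ^ 2 * α / (α ^ 2 + t ^ 2) ≤ 4 * π ^ 2 / α := by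
  rw [div_le_div_iff₀ (by positivity) hα]
  nlinarith [mul_nonneg (sq_nonneg π) (sq_nonneg t)]

theorem add_sq_mul_inv_le {α t : ℝ} (hα : 0 < α) (hα' : α ≤ 1) (ht : |t| ≤ π) :
    (α ^ 2 + t ^ 2) * α⁻¹ ≤ 1 + π ^ 2 / α := by
  have ht_sq : t ^ 2 ≤ π ^ 2 := sq_le_sq' (abs_le.1 ht).1 (abs_le.1 ht).2
  calc (α ^ 2 + t ^ 2) * α⁻¹ = α + t ^ 2 / α := by field_simp
    _ ≤ 1 + π ^ 2 / α := by gcongr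

namespace CFTData

variable {S : CFTData}

theorem realReducedZ_le {a b : ℝ} (hb : 0 ≤ b) :
    S.realReducedZ a b ≤ Real.exp (S.A * (a + b)) * (1 + S.realPrimarySum a b) := by
  have hvac : (1 - Real.exp (-a)) * (1 - Real.exp (-b)) ≤ 1 :=
    mul_le_one₀ (by linarith [Real.exp_pos (-a)]) (one_sub_exp_neg_nonneg hb)
      (by linarith [Real.exp_pos (-b)])
  unfold realReducedZ
  gcongr

namespace IsModularCFT

theorem exp_mul_vacuum_le_realReducedZ (hS : S.IsModularCFT) {a b : ℝ} (ha : 0 ≤ a)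
    (hb : 0 ≤ b) :
    Real.exp (S.A * b) * ((1 - Real.exp (-a)) * (1 - Real.exp (-b))) ≤ S.realReducedZ a b := by
  have hA := hS.A_pos
  have ha' := one_sub_exp_neg_nonneg ha
  have hb' := one_sub_exp_neg_nonneg hb
  unfold realReducedZ
  gcongr
  · exact le_add_of_nonneg_left ha
  · exact le_add_of_nonneg_right (realPrimarySum_nonneg a b)

theorem realPrimarySum_le_realReducedZ (hS : S.IsModularCFT) {a b : ℝ} (ha : 0 ≤ a)
    (hb : 0 ≤ b) : S.realPrimarySum a b ≤ S.realReducedZ a b := by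
  have hvac := mul_nonneg (one_sub_exp_neg_nonneg ha) (one_sub_exp_neg_nonneg hb)
  have hP := realPrimarySum_nonneg (S := S) a b
  have hexp : 1 ≤ Real.exp (S.A * (a + b)) :=
    Real.one_le_exp (mul_nonneg hS.A_pos.le (add_nonneg ha hb))
  unfold realReducedZ
  nlinarith

theorem realPrimarySum_le (hS : S.IsModularCFT) {a b : ℝ} (ha : 0 < a) (hb : 0 < b)
    (ha' : a ≤ 2 * π) (hb' : b ≤ 2 * π) :
    S.realPrimarySum a b ≤ (1 + S.realPrimarySum (2 * π) (2 * π)) *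
      (√(4 * π ^ 2 / (a * b)) * Real.exp (S.A * (4 * π ^ 2 / a + 4 * π ^ 2 / b))) := by
  calc S.realPrimarySum a b
      ≤ S.realReducedZ a b := hS.realPrimarySum_le_realReducedZ ha.le hb.le
    _ = √(4 * π ^ 2 / (a * b)) * S.realReducedZ (4 * π ^ 2 / a) (4 * π ^ 2 / b) :=
      hS.realReducedZ_inversion ha hb
    _ ≤ √(4 * π ^ 2 / (a * b)) * (Real.exp (S.A * (4 * π ^ 2 / a + 4 * π ^ 2 / b)) *
        (1 + S.realPrimarySum (2 * π) (2 * π))) := by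
      refine mul_le_mul_of_nonneg_left ((realReducedZ_le (by positivity)).trans ?_)
        (Real.sqrt_nonneg _)
      gcongr
      exact hS.realPrimarySum_antitone (by positivity) (two_pi_le_four_pi_sq_div ha ha')
        (by positivity) (two_pi_le_four_pi_sq_div hb hb')
    _ = _ := by ring

theorem exists_realPrimarySum_le_exp_neg (hS : S.IsModularCFT) :
    ∃ C, 0 ≤ C ∧ ∀ x u : ℝ, 1 ≤ x → 2 * π ≤ u →
      S.realPrimarySum x (4 * π ^ 2 / u) ≤
        C * Real.exp (-S.Tgap * x) * (√u * Real.exp (S.A * u)) := by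
  have hP := realPrimarySum_nonneg (S := S) (2 * π) (2 * π)
  refine ⟨(1 + S.realPrimarySum (2 * π) (2 * π)) * Real.exp (S.Tgap + 4 * π ^ 2 * S.A),
    by positivity, fun x u hx hu => ?_⟩
  have hu₀ : 0 < u := Real.two_pi_pos.trans_le hu
  have hy : 0 < 4 * π ^ 2 / u := by positivity
  have hy' : 4 * π ^ 2 / u ≤ 2 * π := by
    rw [div_le_iff₀ hu₀]
    nlinarith [Real.pi_pos]
  calc S.realPrimarySum x (4 * π ^ 2 / u)
      ≤ Real.exp (-S.Tgap * (x - 1) - S.Tgap * (4 * π ^ 2 / u - 4 * π ^ 2 / u)) *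
          S.realPrimarySum 1 (4 * π ^ 2 / u) :=
        hS.realPrimarySum_le_exp_mul one_pos hx hy le_rfl
    _ ≤ Real.exp (-S.Tgap * (x - 1)) * ((1 + S.realPrimarySum (2 * π) (2 * π)) *
          (√u * Real.exp (S.A * (4 * π ^ 2 + u)))) := by
      rw [sub_self, mul_zero, sub_zero]
      gcongr
      have h := hS.realPrimarySum_le one_pos hy (by linarith [Real.pi_gt_three]) hy'
      rwa [one_mul, div_one, div_div_cancel₀ (by positivity)] at h
    _ = _ := by
      rw [show -S.Tgap * (x - 1) = S.Tgap + -S.Tgap * x by ring, mul_add S.A, Real.exp_add,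
        Real.exp_add, Real.exp_add, mul_comm S.A (4 * π ^ 2)]
      ring

/-- Send `β_R → 0` at fixed `β_L = x`: the left side is the growth rate of the dual vacuum, the
right side that of the primaries, which are suppressed by the gap. -/
theorem exists_vacuum_le_exp (hS : S.IsModularCFT) :
    ∃ C, ∀ x : ℝ, 1 ≤ x →
      (√x)⁻¹ * (1 - Real.exp (-(4 * π ^ 2 / x))) ≤ C * Real.exp (-(S.Tgap - S.A) * x) := by
  obtain ⟨C, hC, hP⟩ := hS.exists_realPrimarySum_le_exp_neg
  refine ⟨C, fun x hx => ?_⟩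
  have hx₀ : 0 < x := by linarith
  have hA := hS.A_pos
  have hbound : ∀ᶠ u : ℝ in atTop,
      (√x)⁻¹ * ((1 - Real.exp (-(4 * π ^ 2 / x))) * (1 - Real.exp (-u))) ≤
        Real.exp (S.A * (x + 4 * π ^ 2 / u)) *
          ((√u * Real.exp (S.A * u))⁻¹ + C * Real.exp (-S.Tgap * x)) := by
    filter_upwards [eventually_ge_atTop (2 * π)] with u hu
    have hu₀ : 0 < u := Real.two_pi_pos.trans_le hu
    have hlow := hS.exp_mul_vacuum_le_realReducedZ (a := 4 * π ^ 2 / x) (by positivity) hu₀.le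
    have hhigh := (realReducedZ_le (S := S) (a := x) (b := 4 * π ^ 2 / u) (by positivity)).trans
      (mul_le_mul_of_nonneg_left (add_le_add_right (hP x u hx hu) 1) (Real.exp_pos _).le)
    rw [hS.realReducedZ_inversion hx₀ (by positivity), div_div_cancel₀ (by positivity),
      show 4 * π ^ 2 / (x * (4 * π ^ 2 / u)) = x⁻¹ * u by field_simp,
      Real.sqrt_mul (by positivity), Real.sqrt_inv] at hhigh
    refine le_of_mul_le_mul_left ?_ (show 0 < √u * Real.exp (S.A * u) by positivity)
    calc _ = (√x)⁻¹ * √u * (Real.exp (S.A * u) * ((1 - Real.exp (-(4 * π ^ 2 / x))) *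
          (1 - Real.exp (-u)))) := by ring
      _ ≤ (√x)⁻¹ * √u * S.realReducedZ (4 * π ^ 2 / x) u := by gcongr
      _ ≤ _ := hhigh
      _ = _ := by field_simp
  have hexp : Tendsto (fun u : ℝ => Real.exp (-u)) atTop (𝓝 0) :=
    Real.tendsto_exp_neg_atTop_nhds_zero
  have hE : Tendsto (fun u : ℝ => (√u * Real.exp (S.A * u))⁻¹) atTop (𝓝 0) :=
    (Real.tendsto_sqrt_atTop.atTop_mul_atTop₀
      (Real.tendsto_exp_atTop.comp (tendsto_id.const_mul_atTop hA))).inv_tendsto_atTop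
  have hdiv : Tendsto (fun u : ℝ => 4 * π ^ 2 / u) atTop (𝓝 0) :=
    tendsto_const_nhds.div_atTop tendsto_id
  have hlim := le_of_tendsto_of_tendsto
    (((hexp.const_sub 1).const_mul (1 - Real.exp (-(4 * π ^ 2 / x)))).const_mul (√x)⁻¹)
    (((Real.continuous_exp.tendsto _).comp ((hdiv.const_add x).const_mul S.A)).mul
      (hE.add_const (C * Real.exp (-S.Tgap * x)))) hbound
  rw [sub_zero, mul_one, add_zero, zero_add] at hlim
  refine hlim.trans_eq ?_
  rw [mul_left_comm, ← Real.exp_add]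
  ring_nf

theorem Tgap_le_A (hS : S.IsModularCFT) : S.Tgap ≤ S.A := by
  by_contra! h
  obtain ⟨C, hC⟩ := hS.exists_vacuum_le_exp
  have hlim := (tendsto_rpow_mul_exp_neg_mul_atTop_nhds_zero 2 (S.Tgap - S.A)
    (sub_pos.2 h)).const_mul (2 * C)
  rw [mul_zero] at hlim
  refine (ge_of_tendsto hlim ?_).not_gt one_pos
  filter_upwards [eventually_ge_atTop 1] with x hx
  have hx₀ : 0 < x := by linarith
  have hpi : 9 ≤ π ^ 2 := by nlinarith [Real.pi_gt_three]
  have hvac : (x * (2 * x))⁻¹ ≤ (√x)⁻¹ * (1 - Real.exp (-(4 * π ^ 2 / x))) := by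
    rw [mul_inv]
    gcongr
    · exact Real.sqrt_le_iff.2 ⟨hx₀.le, by nlinarith⟩
    · refine le_trans ?_ (div_one_add_le_one_sub_exp_neg (by positivity))
      rw [show 4 * π ^ 2 / x / (1 + 4 * π ^ 2 / x) = 4 * π ^ 2 / (x + 4 * π ^ 2) by field_simp,
        inv_eq_one_div, div_le_div_iff₀ (by positivity) (by positivity)]
      nlinarith
  have h := hvac.trans (hC x hx)
  rw [inv_le_iff_one_le_mul₀ (by positivity)] at h
  rw [Real.rpow_two]
  linarith

theorem exists_exp_mul_realPrimarySum_le_of_two_pi_le (hS : S.IsModularCFT) :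
    ∃ C, 0 ≤ C ∧ ∀ a b : ℝ, 0 < a → a ≤ 1 → 2 * π ≤ b →
      Real.exp (S.A * b) * S.realPrimarySum a b ≤
        C * Real.exp ((2 * π + 4 * π ^ 2 * S.A) / a) * Real.exp ((S.A - S.Tgap) * b) := by
  have hP := realPrimarySum_nonneg (S := S) (2 * π) (2 * π)
  refine ⟨(1 + S.realPrimarySum (2 * π) (2 * π)) * Real.exp (2 * π * S.Tgap + 2 * π * S.A),
    by positivity, fun a b ha ha' hb => ?_⟩
  have hpi := Real.pi_gt_three
  have hgap := hS.realPrimarySum_le_exp_mul ha le_rfl Real.two_pi_pos hb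
  have hdual := hS.realPrimarySum_le ha Real.two_pi_pos (by linarith) le_rfl
  rw [show 4 * π ^ 2 / (2 * π) = 2 * π by field_simp; norm_num,
    show 4 * π ^ 2 / (a * (2 * π)) = 2 * π / a by field_simp; norm_num] at hdual
  rw [sub_self, mul_zero, zero_sub] at hgap
  calc Real.exp (S.A * b) * S.realPrimarySum a b
      ≤ Real.exp (S.A * b) * (Real.exp (-(S.Tgap * (b - 2 * π))) *
          ((1 + S.realPrimarySum (2 * π) (2 * π)) *
            (Real.exp (2 * π / a) * Real.exp (S.A * (4 * π ^ 2 / a + 2 * π))))) := by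
        gcongr
        refine hgap.trans (mul_le_mul_of_nonneg_left (hdual.trans ?_) (Real.exp_pos _).le)
        gcongr
        exact sqrt_le_exp (by positivity)
    _ = (1 + S.realPrimarySum (2 * π) (2 * π)) * (Real.exp (S.A * b) *
          Real.exp (-(S.Tgap * (b - 2 * π))) *
            (Real.exp (2 * π / a) * Real.exp (S.A * (4 * π ^ 2 / a + 2 * π)))) := by ring
    _ = _ := by
      simp only [mul_assoc, ← Real.exp_add]
      ring_nf

theorem exists_exp_mul_realPrimarySum_le_of_le_two_pi (hS : S.IsModularCFT) :
    ∃ C, 0 ≤ C ∧ ∀ a b : ℝ, 0 < a → a ≤ 1 → 0 < b → b ≤ 2 * π →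
      Real.exp (S.A * b) * S.realPrimarySum a b ≤
        C * Real.exp ((2 * π + 4 * π ^ 2 * S.A) / a) *
          (4 * π ^ 2 / b * Real.exp (S.A * (4 * π ^ 2 / b))) := by
  have hP := realPrimarySum_nonneg (S := S) (2 * π) (2 * π)
  have hpi := Real.pi_gt_three
  have hA := hS.A_pos
  refine ⟨Real.exp (S.A * (2 * π)) * (1 + S.realPrimarySum (2 * π) (2 * π)),
    by positivity, fun a b ha ha' hb hb' => ?_⟩
  have hsqrt : √(4 * π ^ 2 / (a * b)) ≤ Real.exp (2 * π / a) * (4 * π ^ 2 / b) := by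
    have hy := two_pi_le_four_pi_sq_div hb hb'
    rw [show 4 * π ^ 2 / (a * b) = a⁻¹ * (4 * π ^ 2 / b) by field_simp,
      Real.sqrt_mul (by positivity)]
    gcongr
    · refine (sqrt_le_exp (by positivity)).trans (Real.exp_le_exp.2 ?_)
      rw [inv_eq_one_div]
      gcongr
      linarith
    · exact Real.sqrt_le_iff.2 ⟨by linarith, by nlinarith⟩
  calc Real.exp (S.A * b) * S.realPrimarySum a b
      ≤ Real.exp (S.A * (2 * π)) * ((1 + S.realPrimarySum (2 * π) (2 * π)) *
          (Real.exp (2 * π / a) * (4 * π ^ 2 / b) *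
            Real.exp (S.A * (4 * π ^ 2 / a + 4 * π ^ 2 / b)))) := by
        have hdual := hS.realPrimarySum_le ha hb (by linarith) hb'
        have := realPrimarySum_nonneg (S := S) a b
        gcongr
        refine hdual.trans ?_
        gcongr
    _ = _ := by
      rw [mul_add, add_div, Real.exp_add, Real.exp_add]
      ring_nf

/-- On the contour `z = α + it` one has `Re (4π² / z) = 4π²α / (α² + t²)`, which is at most
`4π² / α`. Where it is at least `2π` the gap gains the factor `e^{-4π²Tgap / α}`; where it is
smaller, a second modular transformation bounds the primaries by `e^{A (α² + t²) / α}`, which is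
small compared to `e^{4π²A / α}` because `|t| ≤ π`. -/
theorem exists_exp_mul_realPrimarySum_contour_le (hS : S.IsModularCFT) :
    ∃ C K κ : ℝ, 0 ≤ C ∧ 0 ≤ K ∧ 0 < κ ∧
      ∀ α t a : ℝ, 0 < α → α ≤ 1 → |t| ≤ π → 0 < a → a ≤ 1 →
        Real.exp (S.A * (4 * π ^ 2 * α / (α ^ 2 + t ^ 2))) *
            S.realPrimarySum a (4 * π ^ 2 * α / (α ^ 2 + t ^ 2)) ≤
          C * Real.exp (K / a) * (α⁻¹ * Real.exp ((4 * π ^ 2 * S.A - κ) / α)) := by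
  obtain ⟨C₁, hC₁, hlarge⟩ := hS.exists_exp_mul_realPrimarySum_le_of_two_pi_le
  obtain ⟨C₂, hC₂, hsmall⟩ := hS.exists_exp_mul_realPrimarySum_le_of_le_two_pi
  have hA := hS.A_pos
  have hT := hS.Tgap_pos
  set κ := min (4 * π ^ 2 * S.Tgap) (3 * π ^ 2 * S.A)
  refine ⟨max C₁ (C₂ * ((1 + π ^ 2) * Real.exp S.A)), 2 * π + 4 * π ^ 2 * S.A, κ,
    le_max_of_le_left hC₁, by positivity, by positivity, fun α t a hα hα' ht ha ha' => ?_⟩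
  have hα_inv : 1 ≤ α⁻¹ := (one_le_inv₀ hα).2 hα'
  have hb : 0 < 4 * π ^ 2 * α / (α ^ 2 + t ^ 2) := by positivity
  rcases le_total (2 * π) (4 * π ^ 2 * α / (α ^ 2 + t ^ 2)) with hcase | hcase
  · have hexponent : (S.A - S.Tgap) * (4 * π ^ 2 * α / (α ^ 2 + t ^ 2)) ≤
        (4 * π ^ 2 * S.A - κ) / α := by
      calc _ ≤ (S.A - S.Tgap) * (4 * π ^ 2 / α) := mul_le_mul_of_nonneg_left
            (four_pi_sq_mul_div_add_sq_le hα t) (sub_nonneg.2 hS.Tgap_le_A)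
        _ = (4 * π ^ 2 * S.A - 4 * π ^ 2 * S.Tgap) / α := by ring
        _ ≤ _ := by
          gcongr
          exact min_le_left _ _
    refine (hlarge a _ ha ha' hcase).trans ?_
    gcongr
    · exact le_max_left _ _
    · exact (Real.exp_le_exp.2 hexponent).trans
        (le_mul_of_one_le_left (Real.exp_pos _).le hα_inv)
  · have hdual : 4 * π ^ 2 / (4 * π ^ 2 * α / (α ^ 2 + t ^ 2)) = (α ^ 2 + t ^ 2) * α⁻¹ := by
      field_simp
    have hsum := add_sq_mul_inv_le hα hα' ht
    have hprefactor : (α ^ 2 + t ^ 2) * α⁻¹ ≤ (1 + π ^ 2) * α⁻¹ :=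
      hsum.trans (by rw [add_mul, one_mul, div_eq_mul_inv]; gcongr)
    have hexponent : S.A * ((α ^ 2 + t ^ 2) * α⁻¹) ≤ S.A + (4 * π ^ 2 * S.A - κ) / α := by
      calc _ ≤ S.A * (1 + π ^ 2 / α) := by gcongr
        _ = S.A + (4 * π ^ 2 * S.A - 3 * π ^ 2 * S.A) / α := by ring
        _ ≤ _ := by
          gcongr
          exact min_le_right _ _
    refine (hsmall a _ ha ha' hb hcase).trans ?_
    rw [hdual]
    calc _ ≤ C₂ * Real.exp ((2 * π + 4 * π ^ 2 * S.A) / a) * ((1 + π ^ 2) * α⁻¹ *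
          Real.exp (S.A + (4 * π ^ 2 * S.A - κ) / α)) := by gcongr
      _ = C₂ * ((1 + π ^ 2) * Real.exp S.A) * Real.exp ((2 * π + 4 * π ^ 2 * S.A) / a) *
          (α⁻¹ * Real.exp ((4 * π ^ 2 * S.A - κ) / α)) := by
        rw [Real.exp_add]
        ring
      _ ≤ _ := by
        gcongr
        exact le_max_right _ _

end IsModularCFT

end CFTData

/-! ### The vacuum density -/

theorem integral_vertical_intervalIntegral_eq_zero {q : ℂ → ℝ → ℂ} {β C r a b : ℝ} (hr : 1 < r)
    (hc : Continuous fun p : ℝ × ℝ => q (β + p.1 * I) p.2)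
    (hd : ∀ t ∈ uIoc a b, ∀ w : ℂ, β ≤ w.re → DifferentiableAt ℂ (q · t) w)
    (hq : ∀ t ∈ uIoc a b, ∀ w : ℂ, β ≤ w.re → ‖q w t‖ ≤ C * (1 + ‖w‖) ^ (-r)) :
    ∫ s : ℝ, ∫ t in a..b, q (β + s * I) t = 0 := by
  set μ : Measure ℝ := volume.restrict (uIoc a b) with hμ
  have hfin : IsFiniteMeasure μ := by
    rw [hμ, uIoc]
    infer_instance
  have hbound : Integrable fun s : ℝ => C * (1 + ‖(β + s * I : ℂ)‖) ^ (-r) := by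
    have := integrable_vertical (q := fun w => ((1 + ‖w‖) ^ (-r) : ℝ)) (β := β) (C := 1) hr
      (Complex.continuous_ofReal.comp <| Continuous.rpow_const (by fun_prop) fun s =>
        .inl (by positivity))
      fun s => by
        rw [Complex.norm_real, Real.norm_of_nonneg (by positivity), one_mul]
    exact (by simpa using this.re : Integrable fun s : ℝ => _).const_mul C
  have hint : Integrable (Function.uncurry fun t s : ℝ => q (β + s * I) t) (μ.prod volume) := by
    refine (hbound.comp_snd μ).mono' (hc.comp continuous_swap).aestronglyMeasurable ?_
    filter_upwards [Measure.quasiMeasurePreserving_fst.ae (ae_restrict_mem measurableSet_uIoc)]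
      with p hp using hq _ hp _ (by simp)
  rw [← intervalIntegral_integral_swap hint]
  exact intervalIntegral.integral_zero_ae <| .of_forall fun t ht =>
    integral_vertical_eq_zero (q := (q · t)) hr (hd t ht) (hq t ht)

theorem one_add_norm_le_mul_norm_sub {E : Type*} [SeminormedAddCommGroup E] {w z : E} {m M : ℝ}
    (hm : 0 < m) (hz : ‖z‖ ≤ M) (hwz : m ≤ ‖w - z‖) :
    1 + ‖w‖ ≤ (1 + (1 + M) / m) * ‖w - z‖ := by
  have hM : 0 ≤ M := (norm_nonneg z).trans hz
  calc 1 + ‖w‖ ≤ 1 + (‖w - z‖ + M) := by linarith [norm_le_norm_sub_add w z]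
    _ = ‖w - z‖ + (1 + M) / m * m := by
        field_simp
        ring
    _ ≤ ‖w - z‖ + (1 + M) / m * ‖w - z‖ := by gcongr
    _ = (1 + (1 + M) / m) * ‖w - z‖ := by ring

theorem mul_re_four_pi_sq_div_le {A m : ℝ} {w : ℂ} (hA : 0 ≤ A) (hm : 0 < m) (hw : m ≤ ‖w‖) :
    A * (4 * (π : ℂ) ^ 2 / w).re ≤ 4 * π ^ 2 * A / m := by
  have hnorm : ‖4 * (π : ℂ) ^ 2 / w‖ = 4 * π ^ 2 / ‖w‖ := by
    simp [abs_of_pos Real.pi_pos]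
  calc A * (4 * (π : ℂ) ^ 2 / w).re ≤ A * (4 * π ^ 2 / ‖w‖) := by
        rw [← hnorm]
        gcongr
        exact Complex.re_le_norm _
    _ ≤ A * (4 * π ^ 2 / m) := by gcongr
    _ = 4 * π ^ 2 * A / m := by ring

/-- The factor common to the vacuum and the primaries of the dual channel in the spin-`J` Fourier
integral: `vacIntegrand` is `dualFactor` times the vacuum character
`(1 - e^{-4π²/(β_L - z)}) (1 - e^{-4π²/z})`, and the primaries contribute `dualFactor` times
`primarySum (4π²/(β_L - z)) (4π²/z)`. -/
def dualFactor (A : ℝ) (J : ℤ) (βL z : ℂ) : ℂ :=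
  Complex.exp (z * J) * (4 * π ^ 2 / (z * (βL - z))) ^ (1 / 2 : ℂ) *
    Complex.exp (4 * π ^ 2 * A / (βL - z) + 4 * π ^ 2 * A / z)

theorem vacIntegrand_eq_dualFactor_mul (A : ℝ) (J : ℤ) (βL z : ℂ) :
    vacIntegrand A J βL z = dualFactor A J βL z *
      (1 - Complex.exp (-(4 * π ^ 2 / (βL - z)))) * (1 - Complex.exp (-(4 * π ^ 2 / z))) :=
  rfl

theorem continuous_vacIntegrand {X : Type*} [TopologicalSpace X] (A : ℝ) (J : ℤ)
    {βL z : X → ℂ} (hβ : Continuous βL) (hz : Continuous z) (hz₀ : ∀ x, 0 < (z x).re)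
    (hw₀ : ∀ x, (z x).re < (βL x).re) : Continuous fun x => vacIntegrand A J (βL x) (z x) := by
  have hw : ∀ x, 0 < (βL x - z x).re := fun x => by simpa using hw₀ x
  have hz' : ∀ x, z x ≠ 0 := fun x => Complex.ne_zero_of_re_pos (hz₀ x)
  have hw' : ∀ x, βL x - z x ≠ 0 := fun x => Complex.ne_zero_of_re_pos (hw x)
  have hzw : ∀ x, z x * (βL x - z x) ≠ 0 := fun x => mul_ne_zero (hz' x) (hw' x)
  have hsqrt : Continuous fun x => (4 * (π : ℂ) ^ 2 / (z x * (βL x - z x))) ^ (1 / 2 : ℂ) :=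
    Continuous.cpow (by fun_prop (disch := assumption)) continuous_const fun x =>
      four_pi_sq_div_mul_mem_slitPlane (hz₀ x) (hw x)
  unfold vacIntegrand
  fun_prop (disch := assumption)

theorem differentiableAt_vacIntegrand (A : ℝ) (J : ℤ) {βL z : ℂ} (hz₀ : 0 < z.re)
    (hw₀ : z.re < βL.re) : DifferentiableAt ℂ (fun b => vacIntegrand A J b z) βL := by
  have hw : 0 < (βL - z).re := by simpa using hw₀
  have hw' : βL - z ≠ 0 := Complex.ne_zero_of_re_pos hw
  have hzw : z * (βL - z) ≠ 0 := mul_ne_zero (Complex.ne_zero_of_re_pos hz₀) hw'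
  have hsqrt : DifferentiableAt ℂ
      (fun b => (4 * (π : ℂ) ^ 2 / (z * (b - z))) ^ (1 / 2 : ℂ)) βL :=
    DifferentiableAt.cpow (by fun_prop (disch := assumption)) (differentiableAt_const _)
      (four_pi_sq_div_mul_mem_slitPlane hz₀ hw)
  unfold vacIntegrand
  fun_prop (disch := assumption)

theorem inv_alphaJ {A : ℝ} (hA : 0 ≤ A) (J : ℤ) : (alphaJ A J)⁻¹ = √J / (2 * π * √A) := by
  rw [alphaJ, Real.sqrt_div hA, ← mul_div_assoc, inv_div]

theorem four_pi_sq_mul_div_alphaJ {A : ℝ} (hA : 0 < A) (J : ℤ) :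
    4 * π ^ 2 * A / alphaJ A J = 2 * π * √(A * J) := by
  have h : √A * √A = A := Real.mul_self_sqrt hA.le
  have : 0 < √A := Real.sqrt_pos.2 hA
  rw [div_eq_mul_inv, inv_alphaJ hA.le, Real.sqrt_mul hA.le]
  field_simp
  linear_combination -4 * √J * h

/-- The spins for which the contour `Re z = alphaJ A J` lies in the strip where the estimates at
abscissa `β` apply; the Fourier modes `J ≥ 2` receive no contribution from the vacuum of the direct
channel. -/
structure IsLargeSpin (A β : ℝ) (J : ℤ) : Prop where
  two_le : 2 ≤ J
  alphaJ_le_one : alphaJ A J ≤ 1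
  alphaJ_le_half : alphaJ A J ≤ β / 2

theorem eventually_isLargeSpin (A : ℝ) {β : ℝ} (hβ : 0 < β) :
    ∀ᶠ J : ℤ in atTop, IsLargeSpin A β J := by
  have h : Tendsto (fun J : ℤ => alphaJ A J) atTop (𝓝 0) := by
    simpa [alphaJ] using ((tendsto_const_nhds (x := A)).div_atTop
      tendsto_intCast_atTop_atTop).sqrt.const_mul (2 * π)
  filter_upwards [eventually_ge_atTop 2, h.eventually_le_const one_pos,
    h.eventually_le_const (half_pos hβ)] with J h₁ h₂ h₃ using ⟨h₁, h₂, h₃⟩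

/-- The exponential growth `e^{4π√(AJ)}` of the spin-`J` spectral density, times a power of `J`
large enough to absorb the singular prefactors of the dual channel. -/
def cardyScale (A : ℝ) (J : ℤ) : ℝ :=
  J * Real.exp (4 * π * √(A * J))

namespace IsLargeSpin

variable {A β : ℝ} {J : ℤ}

theorem cast_pos (hJ : IsLargeSpin A β J) : (0 : ℝ) < J := by
  have := hJ.two_le
  exact_mod_cast (by omega : 0 < J)

theorem alphaJ_pos (hJ : IsLargeSpin A β J) (hA : 0 < A) : 0 < alphaJ A J := by
  have := hJ.cast_pos
  unfold alphaJ
  positivity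

theorem abscissa_pos (hJ : IsLargeSpin A β J) (hA : 0 < A) : 0 < β := by
  linarith [hJ.alphaJ_le_half, hJ.alphaJ_pos hA]

theorem alphaJ_lt (hJ : IsLargeSpin A β J) (hA : 0 < A) : alphaJ A J < β :=
  hJ.alphaJ_le_half.trans_lt (half_lt_self (hJ.abscissa_pos hA))

theorem cardyScale_pos (hJ : IsLargeSpin A β J) : 0 < cardyScale A J :=
  mul_pos hJ.cast_pos (Real.exp_pos _)

theorem alphaJ_mul (hJ : IsLargeSpin A β J) (hA : 0 < A) :
    alphaJ A J * J = 2 * π * √(A * J) := by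
  have h : √(J : ℝ) * √J = J := Real.mul_self_sqrt hJ.cast_pos.le
  have : 0 < √(J : ℝ) := Real.sqrt_pos.2 hJ.cast_pos
  rw [alphaJ, Real.sqrt_div hA.le, Real.sqrt_mul hA.le]
  field_simp
  linear_combination -h

theorem inv_alphaJ_sq (hJ : IsLargeSpin A β J) (hA : 0 < A) :
    (alphaJ A J)⁻¹ ^ 2 = (4 * π ^ 2 * A)⁻¹ * J := by
  rw [inv_alphaJ hA.le, div_pow, mul_pow, Real.sq_sqrt hA.le, Real.sq_sqrt hJ.cast_pos.le]
  field_simp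
  norm_num

theorem norm_dualFactor_le (hJ : IsLargeSpin A β J) (hA : 0 < A) {βL : ℂ} (hβL : β ≤ βL.re)
    (t : ℝ) :
    ‖dualFactor A J βL (alphaJ A J + t * I)‖ ≤
      2 * π * Real.exp (8 * π ^ 2 * A / β) * (Real.exp (2 * π * √(A * J)) * (alphaJ A J)⁻¹) *
        (√‖βL - (alphaJ A J + t * I)‖)⁻¹ *
        Real.exp (A * (4 * (π : ℂ) ^ 2 / (alphaJ A J + t * I)).re) := by
  have hα := hJ.alphaJ_pos hA
  have hβ := hJ.abscissa_pos hA
  set z : ℂ := alphaJ A J + t * I with hz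
  have hzre : z.re = alphaJ A J := by simp [hz]
  have hzα : alphaJ A J ≤ √‖z‖ := by
    refine Real.le_sqrt_of_sq_le ?_
    nlinarith [hJ.alphaJ_le_one, Complex.re_le_norm z]
  have hw : β / 2 ≤ ‖βL - z‖ := by
    refine le_trans ?_ (Complex.re_le_norm _)
    rw [Complex.sub_re]
    linarith [hJ.alphaJ_le_half]
  set w : ℂ := βL - z
  have hphase : ‖Complex.exp (z * J)‖ = Real.exp (2 * π * √(A * J)) := by
    rw [Complex.norm_exp, ← hJ.alphaJ_mul hA, ← hzre, ← Complex.re_mul_ofReal,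
      Complex.ofReal_intCast]
  have hsqrt : ‖(4 * (π : ℂ) ^ 2 / (z * w)) ^ (1 / 2 : ℂ)‖ ≤
      2 * π * ((alphaJ A J)⁻¹ * (√‖w‖)⁻¹) := by
    rw [norm_cpow_one_half, show 4 * (π : ℂ) ^ 2 = (2 * π : ℝ) ^ 2 by push_cast; ring, norm_div,
      norm_pow, norm_mul, Complex.norm_real, Real.norm_of_nonneg Real.two_pi_pos.le,
      Real.sqrt_div (by positivity), Real.sqrt_sq (by positivity), Real.sqrt_mul (norm_nonneg _),
      div_eq_mul_inv, mul_inv]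
    gcongr
  have hexp : ‖Complex.exp (4 * π ^ 2 * A / w + 4 * π ^ 2 * A / z)‖ ≤
      Real.exp (8 * π ^ 2 * A / β) * Real.exp (A * (4 * (π : ℂ) ^ 2 / z).re) := by
    have hre : ∀ u : ℂ, (4 * (π : ℂ) ^ 2 * A / u).re = A * (4 * (π : ℂ) ^ 2 / u).re := fun u => by
      rw [← Complex.re_ofReal_mul, mul_comm _ (A : ℂ), mul_div_assoc]
    have hw_re : A * (4 * (π : ℂ) ^ 2 / w).re ≤ 8 * π ^ 2 * A / β :=
      (mul_re_four_pi_sq_div_le hA.le (half_pos hβ) hw).trans_eq (by ring)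
    rw [Complex.norm_exp, ← Real.exp_add, Complex.add_re, hre, hre]
    gcongr
  rw [dualFactor, norm_mul, norm_mul, hphase]
  calc _ ≤ Real.exp (2 * π * √(A * J)) * (2 * π * ((alphaJ A J)⁻¹ * (√‖w‖)⁻¹)) *
        (Real.exp (8 * π ^ 2 * A / β) * Real.exp (A * (4 * (π : ℂ) ^ 2 / z).re)) := by gcongr
    _ = _ := by ring

end IsLargeSpin

theorem abs_le_pi_of_mem_uIoc {t : ℝ} (ht : t ∈ uIoc (-π) π) : |t| ≤ π := by
  rw [uIoc_of_le (by linarith [Real.pi_pos])] at ht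
  exact abs_le.2 ⟨ht.1.le, ht.2⟩

theorem norm_average_segment_le {f : ℝ → ℂ} {M : ℝ} (hf : ∀ t : ℝ, |t| ≤ π → ‖f t‖ ≤ M) :
    ‖∫ t in (-π)..π, (1 / (2 * π) : ℂ) * f t‖ ≤ M := by
  have hc : ‖(1 / (2 * π) : ℂ)‖ = 1 / (2 * π) := by simp [abs_of_pos Real.pi_pos]
  have h := intervalIntegral.norm_integral_le_of_norm_le_const (a := -π) (b := π)
    (f := fun t => (1 / (2 * π) : ℂ) * f t) (C := 1 / (2 * π) * M) fun t ht => by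
      rw [norm_mul, hc]
      gcongr
      exact hf t (abs_le_pi_of_mem_uIoc ht)
  refine h.trans_eq ?_
  rw [sub_neg_eq_add, ← two_mul, abs_of_pos Real.two_pi_pos]
  field_simp

theorem inv_sqrt_mul_inv_le {a b K : ℝ} (hb : 0 < b) (ha : 0 < a) (h : b ≤ K * a) :
    (√a)⁻¹ * a⁻¹ ≤ K ^ (3 / 2 : ℝ) * b ^ (-(3 / 2) : ℝ) := by
  have hK : 0 < K := pos_of_mul_pos_left (hb.trans_le h) ha.le
  calc (√a)⁻¹ * a⁻¹ = a ^ (-(3 / 2) : ℝ) := by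
        rw [Real.sqrt_eq_rpow, ← Real.rpow_neg ha.le, ← Real.rpow_neg_one, ← Real.rpow_add ha]
        norm_num
    _ = K ^ (3 / 2 : ℝ) * (K * a) ^ (-(3 / 2) : ℝ) := by
        rw [Real.mul_rpow hK.le ha.le, ← mul_assoc, ← Real.rpow_add hK, add_neg_cancel,
          Real.rpow_zero, one_mul]
    _ ≤ K ^ (3 / 2 : ℝ) * b ^ (-(3 / 2) : ℝ) := by
        gcongr K ^ (3 / 2 : ℝ) * ?_
        exact Real.rpow_le_rpow_of_nonpos hb h (by norm_num)

theorem norm_one_sub_exp_mul_one_sub_exp_le {w z : ℂ} (hw : 0 < w.re) (hz : 0 < z.re) :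
    ‖(1 - Complex.exp (-(4 * π ^ 2 / w))) * (1 - Complex.exp (-(4 * π ^ 2 / z)))‖ ≤
      16 * π ^ 2 * ‖w‖⁻¹ := by
  have hnorm : ‖4 * (π : ℂ) ^ 2 / w‖ = 4 * π ^ 2 * ‖w‖⁻¹ := by
    simp [abs_of_pos Real.pi_pos, div_eq_mul_inv]
  calc _ ≤ 2 * (4 * π ^ 2 * ‖w‖⁻¹) * 2 := by
        rw [norm_mul, ← hnorm]
        gcongr
        · exact norm_one_sub_exp_neg_le_two_mul (re_four_pi_sq_div_pos hw).le
        · exact norm_one_sub_exp_neg_le_two (re_four_pi_sq_div_pos hz).le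
    _ = 16 * π ^ 2 * ‖w‖⁻¹ := by ring

theorem IsLargeSpin.norm_dualFactor_le_cardyScale {A β : ℝ} {J : ℤ} (hJ : IsLargeSpin A β J)
    (hA : 0 < A) {βL : ℂ} (hβL : β ≤ βL.re) (t : ℝ) :
    ‖dualFactor A J βL (alphaJ A J + t * I)‖ ≤
      2 * π * Real.exp (8 * π ^ 2 * A / β) * (4 * π ^ 2 * A)⁻¹ * cardyScale A J *
        (√‖βL - (alphaJ A J + t * I)‖)⁻¹ := by
  have hα := hJ.alphaJ_pos hA
  have hexp : Real.exp (A * (4 * (π : ℂ) ^ 2 / (alphaJ A J + t * I)).re) ≤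
      Real.exp (2 * π * √(A * J)) := by
    rw [← four_pi_sq_mul_div_alphaJ hA J]
    refine Real.exp_le_exp.2 (mul_re_four_pi_sq_div_le hA.le hα ?_)
    simpa using Complex.re_le_norm (alphaJ A J + t * I)
  have hα_inv : (alphaJ A J)⁻¹ ≤ (4 * π ^ 2 * A)⁻¹ * J := by
    rw [← hJ.inv_alphaJ_sq hA]
    exact le_self_pow₀ ((one_le_inv₀ hα).2 hJ.alphaJ_le_one) two_ne_zero
  have hscale : cardyScale A J =
      J * (Real.exp (2 * π * √(A * J)) * Real.exp (2 * π * √(A * J))) := by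
    rw [cardyScale, ← Real.exp_add]
    ring_nf
  have := hJ.cast_pos
  calc _ ≤ 2 * π * Real.exp (8 * π ^ 2 * A / β) *
          (Real.exp (2 * π * √(A * J)) * ((4 * π ^ 2 * A)⁻¹ * J)) *
          (√‖βL - (alphaJ A J + t * I)‖)⁻¹ * Real.exp (2 * π * √(A * J)) := by
        refine (hJ.norm_dualFactor_le hA hβL t).trans ?_
        gcongr
    _ = _ := by
        rw [hscale]
        ring

theorem exists_norm_vacIntegrand_le {A β : ℝ} (hA : 0 < A) (hβ : 0 < β) : ∃ C : ℝ,
    ∀ (J : ℤ) (t : ℝ) (βL : ℂ), IsLargeSpin A β J → |t| ≤ π → β ≤ βL.re →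
      ‖vacIntegrand A J βL (alphaJ A J + t * I)‖ ≤
        C * cardyScale A J * (1 + ‖βL‖) ^ (-(3 / 2) : ℝ) := by
  set M : ℝ := 2 * π * Real.exp (8 * π ^ 2 * A / β) * (4 * π ^ 2 * A)⁻¹ with hM
  set K : ℝ := 1 + (1 + (1 + π)) / (β / 2)
  refine ⟨M * (16 * π ^ 2) * K ^ (3 / 2 : ℝ), fun J t βL hJ ht hβL => ?_⟩
  have hα := hJ.alphaJ_pos hA
  have hscale := hJ.cardyScale_pos
  have hfactor := hJ.norm_dualFactor_le_cardyScale hA hβL t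
  rw [← hM] at hfactor
  set z : ℂ := alphaJ A J + t * I with hz
  have hzre : z.re = alphaJ A J := by simp [hz]
  have hzn : ‖z‖ ≤ 1 + π := (Complex.norm_le_abs_re_add_abs_im z).trans <| add_le_add
    (by rw [hzre, abs_of_pos hα]; exact hJ.alphaJ_le_one) (by simpa [hz] using ht)
  have hwre : β / 2 ≤ (βL - z).re := by
    rw [Complex.sub_re]
    linarith [hJ.alphaJ_le_half]
  have hwn : β / 2 ≤ ‖βL - z‖ := hwre.trans (Complex.re_le_norm _)
  have hdecay := inv_sqrt_mul_inv_le (by positivity : 0 < 1 + ‖βL‖) ((half_pos hβ).trans_le hwn)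
    (one_add_norm_le_mul_norm_sub (half_pos hβ) hzn hwn)
  rw [vacIntegrand_eq_dualFactor_mul, mul_assoc, norm_mul]
  calc _ ≤ M * cardyScale A J * (√‖βL - z‖)⁻¹ * (16 * π ^ 2 * ‖βL - z‖⁻¹) := by
        gcongr
        exact norm_one_sub_exp_mul_one_sub_exp_le ((half_pos hβ).trans_le hwre) (by rwa [hzre])
    _ = M * (16 * π ^ 2) * cardyScale A J * ((√‖βL - z‖)⁻¹ * ‖βL - z‖⁻¹) := by ring
    _ ≤ M * (16 * π ^ 2) * cardyScale A J *
        (K ^ (3 / 2 : ℝ) * (1 + ‖βL‖) ^ (-(3 / 2) : ℝ)) := by gcongr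
    _ = _ := by ring

theorem exists_norm_Fvac_le {A β : ℝ} (hA : 0 < A) (hβ : 0 < β) : ∃ C : ℝ,
    ∀ (J : ℤ) (βL : ℂ), IsLargeSpin A β J → β ≤ βL.re →
      ‖Fvac A βL J‖ ≤ C * cardyScale A J * (1 + ‖βL‖) ^ (-(3 / 2) : ℝ) := by
  obtain ⟨C, hC⟩ := exists_norm_vacIntegrand_le hA hβ
  exact ⟨C, fun J βL hJ hβL => norm_average_segment_le fun t ht => hC J t βL hJ ht hβL⟩

namespace IsLargeSpin

variable {A β : ℝ} {J : ℤ}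

theorem continuous_vacIntegrand_contour (hJ : IsLargeSpin A β J) (hA : 0 < A) :
    Continuous fun p : ℝ × ℝ => vacIntegrand A J (β + p.1 * I) (alphaJ A J + p.2 * I) := by
  refine continuous_vacIntegrand A J (by fun_prop) (by fun_prop) (fun p => ?_) (fun p => ?_)
  · simpa using hJ.alphaJ_pos hA
  · simpa using hJ.alphaJ_lt hA

theorem continuous_Fvac_vertical (hJ : IsLargeSpin A β J) (hA : 0 < A) :
    Continuous fun s : ℝ => Fvac A (β + s * I) J :=
  intervalIntegral.continuous_parametric_intervalIntegral_of_continuous'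
    (continuous_const.mul (hJ.continuous_vacIntegrand_contour hA)) _ _

theorem integrable_Fvac_vertical (hJ : IsLargeSpin A β J) (hA : 0 < A) :
    Integrable fun s : ℝ => Fvac A (β + s * I) J := by
  obtain ⟨C, hC⟩ := exists_norm_Fvac_le hA (hJ.abscissa_pos hA)
  exact integrable_vertical (q := fun w => Fvac A w J) (by norm_num : (1 : ℝ) < 3 / 2)
    (hJ.continuous_Fvac_vertical hA) fun s => hC J _ hJ (by simp)

theorem integrable_rhoVacIntegrand (hJ : IsLargeSpin A β J) (hA : 0 < A) (h : ℝ) :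
    Integrable (rhoVacIntegrand A β J h) := by
  refine ((hJ.integrable_Fvac_vertical hA).const_mul _).mul_bdd
    (c := Real.exp (β * (h - A))) (by fun_prop) (.of_forall fun s => ?_)
  simp [Complex.norm_exp]

theorem continuous_rhoVac (hJ : IsLargeSpin A β J) (hA : 0 < A) :
    Continuous (rhoVac A β J) := by
  refine continuous_const.mul (continuous_iff_continuousAt.2 fun h₀ => ?_)
  refine continuousAt_of_dominated (bound := fun s => ‖(1 / (2 * π) : ℂ) * Fvac A (β + s * I) J‖ *
    Real.exp (β * (h₀ + 1 - A))) (.of_forall fun h => ?_) ?_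
    (((hJ.integrable_Fvac_vertical hA).const_mul _).norm.mul_const _)
    (.of_forall fun s => by unfold rhoVacIntegrand; fun_prop)
  · exact (hJ.integrable_rhoVacIntegrand hA h).aestronglyMeasurable
  · filter_upwards [Iio_mem_nhds (lt_add_one h₀)] with h hh
    refine .of_forall fun s => ?_
    rw [rhoVacIntegrand, norm_mul, Complex.norm_exp]
    gcongr
    simpa using mul_le_mul_of_nonneg_left (sub_le_sub_right hh.le A) (hJ.abscissa_pos hA).le

-- Close the contour in the right half plane, where `e^{w(h - A)}` is bounded.
theorem rhoVac_eq_zero (hJ : IsLargeSpin A β J) (hA : 0 < A) {h : ℝ} (hh : h ≤ A) :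
    rhoVac A β J h = 0 := by
  obtain ⟨C, hC⟩ := exists_norm_vacIntegrand_le hA (hJ.abscissa_pos hA)
  have hα := hJ.alphaJ_pos hA
  have hzero : ∫ s : ℝ, ∫ t in (-π)..π, vacIntegrand A J (β + s * I) (alphaJ A J + t * I) *
      Complex.exp ((β + s * I) * (h - A)) = 0 := by
    refine integral_vertical_intervalIntegral_eq_zero (C := C * cardyScale A J)
      (q := fun w t => vacIntegrand A J w (alphaJ A J + t * I) * Complex.exp (w * (h - A)))
      (by norm_num : (1 : ℝ) < 3 / 2)
      ((hJ.continuous_vacIntegrand_contour hA).mul (by fun_prop)) (fun t _ w hw => ?_)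
      (fun t ht w hw => ?_)
    · refine (differentiableAt_vacIntegrand A J (by simpa using hα) ?_).mul (by fun_prop)
      simpa using (hJ.alphaJ_lt hA).trans_le hw
    · have hexp : ‖Complex.exp (w * (h - A))‖ ≤ 1 := by
        rw [Complex.norm_exp, Real.exp_le_one_iff, ← Complex.ofReal_sub, Complex.re_mul_ofReal]
        exact mul_nonpos_of_nonneg_of_nonpos ((hJ.abscissa_pos hA).le.trans hw) (by linarith)
      rw [norm_mul]
      exact (mul_le_of_le_one_right (norm_nonneg _) hexp).trans
        (hC J t w hJ (abs_le_pi_of_mem_uIoc ht) hw)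
  have hintegrand : ∀ s : ℝ, rhoVacIntegrand A β J h s = (1 / (2 * π) * (1 / (2 * π)) : ℂ) *
      ∫ t in (-π)..π, vacIntegrand A J (β + s * I) (alphaJ A J + t * I) *
        Complex.exp ((β + s * I) * (h - A)) := fun s => by
    rw [rhoVacIntegrand, Fvac, intervalIntegral.integral_const_mul,
      intervalIntegral.integral_mul_const]
    ring
  simp_rw [rhoVac, hintegrand]
  rw [integral_const_mul, hzero, mul_zero, mul_zero]

end IsLargeSpin

/-! ### The dual channel -/

theorem exists_inv_le_re_four_pi_sq_div_sub {β : ℝ} (hβ : 0 < β) : ∃ C : ℝ, 1 ≤ C ∧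
    ∀ α s t : ℝ, 0 ≤ α → α ≤ β / 2 → |t| ≤ π →
      (C * (1 + s ^ 2))⁻¹ ≤ (4 * (π : ℂ) ^ 2 / (β + s * I - (α + t * I))).re := by
  set M : ℝ := β ^ 2 + 2 * π ^ 2 + 2
  refine ⟨1 + M / (2 * π ^ 2 * β), le_add_of_nonneg_right (by positivity),
    fun α s t hα hαβ ht => ?_⟩
  have hpos : 0 < β - α := by linarith
  have hre : (4 * (π : ℂ) ^ 2 / (β + s * I - (α + t * I))).re =
      4 * π ^ 2 * (β - α) / ((β - α) * (β - α) + (s - t) * (s - t)) := by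
    simp [re_four_pi_sq_div, Complex.normSq_apply]
  have hnorm : (β - α) * (β - α) + (s - t) * (s - t) ≤ M * (1 + s ^ 2) := by
    have ht_sq : t ^ 2 ≤ π ^ 2 := sq_le_sq' (abs_le.1 ht).1 (abs_le.1 ht).2
    have hβ_sq : (β - α) * (β - α) ≤ β ^ 2 := by nlinarith
    have hst : (s - t) * (s - t) ≤ 2 * s ^ 2 + 2 * t ^ 2 := by nlinarith [sq_nonneg (s + t)]
    have hs : 0 ≤ (β ^ 2 + 2 * π ^ 2) * s ^ 2 := by positivity
    linarith
  have hden : 0 < (β - α) * (β - α) + (s - t) * (s - t) :=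
    add_pos_of_pos_of_nonneg (mul_pos hpos hpos) (mul_self_nonneg _)
  rw [hre, inv_eq_one_div, div_le_div_iff₀ (by positivity) hden, one_mul]
  calc (β - α) * (β - α) + (s - t) * (s - t) ≤ M * (1 + s ^ 2) := hnorm
    _ = 2 * π ^ 2 * β * (M / (2 * π ^ 2 * β)) * (1 + s ^ 2) := by field_simp
    _ ≤ 4 * π ^ 2 * (β - α) * (1 + M / (2 * π ^ 2 * β)) * (1 + s ^ 2) := by
        gcongr ?_ * ?_ * (1 + s ^ 2)
        · nlinarith [Real.pi_pos, sq_pos_of_pos Real.pi_pos]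
        · linarith
    _ = _ := by ring

theorem IsLargeSpin.norm_dualFactor_vertical_le {A β : ℝ} {J : ℤ} (hJ : IsLargeSpin A β J)
    (hA : 0 < A) (s t : ℝ) :
    ‖dualFactor A J (β + s * I) (alphaJ A J + t * I)‖ ≤
      2 * π * Real.exp (8 * π ^ 2 * A / β) * (√(β / 2))⁻¹ *
        (Real.exp (2 * π * √(A * J)) * (alphaJ A J)⁻¹) *
        Real.exp (A * (4 * π ^ 2 * alphaJ A J / (alphaJ A J ^ 2 + t ^ 2))) := by
  have hα := hJ.alphaJ_pos hA
  have hβ := hJ.abscissa_pos hA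
  have hre : (4 * (π : ℂ) ^ 2 / (alphaJ A J + t * I)).re =
      4 * π ^ 2 * alphaJ A J / (alphaJ A J ^ 2 + t ^ 2) := by
    simp [re_four_pi_sq_div, Complex.normSq_add_mul_I]
  have hnorm : β / 2 ≤ ‖(β + s * I - (alphaJ A J + t * I) : ℂ)‖ :=
    le_trans (by simpa using by linarith [hJ.alphaJ_le_half]) (Complex.re_le_norm _)
  refine (hJ.norm_dualFactor_le hA (βL := β + s * I) (by simp) t).trans ?_
  rw [hre, mul_right_comm (2 * π * Real.exp (8 * π ^ 2 * A / β))]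
  gcongr

theorem IsLargeSpin.exp_mul_inv_alphaJ_mul_eq {A β : ℝ} {J : ℤ} (hJ : IsLargeSpin A β J)
    (hA : 0 < A) (κ : ℝ) :
    Real.exp (2 * π * √(A * J)) * (alphaJ A J)⁻¹ *
        ((alphaJ A J)⁻¹ * Real.exp ((4 * π ^ 2 * A - κ) / alphaJ A J)) =
      (4 * π ^ 2 * A)⁻¹ * cardyScale A J * Real.exp (-(κ / (2 * π * √A) * √J)) := by
  have hexp : Real.exp (2 * π * √(A * J)) * Real.exp ((4 * π ^ 2 * A - κ) / alphaJ A J) =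
      Real.exp (4 * π * √(A * J)) * Real.exp (-(κ / (2 * π * √A) * √J)) := by
    rw [sub_div, four_pi_sq_mul_div_alphaJ hA, div_eq_mul_inv κ (alphaJ A J), inv_alphaJ hA.le,
      ← Real.exp_add, ← Real.exp_add]
    ring_nf
  calc _ = (alphaJ A J)⁻¹ ^ 2 * (Real.exp (2 * π * √(A * J)) *
          Real.exp ((4 * π ^ 2 * A - κ) / alphaJ A J)) := by ring
    _ = _ := by
        rw [hexp, hJ.inv_alphaJ_sq hA, cardyScale]
        ring

/-- The Laplace transform at `w` of the vacuum density `h ↦ rhoVac A β J h`. -/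
def vacLaplace (A : ℝ) (J : ℤ) (w : ℂ) : ℂ :=
  1 / 2 * Complex.exp (-(A * w)) * Fvac A w J

theorem norm_half_mul_exp_neg_le_one {A : ℝ} (hA : 0 ≤ A) {w : ℂ} (hw : 0 ≤ w.re) :
    ‖(1 / 2 : ℂ) * Complex.exp (-(A * w))‖ ≤ 1 := by
  rw [norm_mul, Complex.norm_exp, Complex.neg_re, Complex.re_ofReal_mul]
  exact mul_le_one₀ (by norm_num) (Real.exp_nonneg _)
    (Real.exp_le_one_iff.2 (neg_nonpos.2 (mul_nonneg hA hw)))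

theorem exists_norm_vacLaplace_le {A β : ℝ} (hA : 0 < A) (hβ : 0 < β) :
    ∃ C : ℝ, 0 ≤ C ∧ ∀ (J : ℤ) (s : ℝ), IsLargeSpin A β J →
      ‖vacLaplace A J (β + s * I)‖ ≤ C * cardyScale A J := by
  obtain ⟨C, hFvac⟩ := exists_norm_Fvac_le hA hβ
  refine ⟨|C|, abs_nonneg C, fun J s hJ => ?_⟩
  have hscale := hJ.cardyScale_pos
  have hdecay : (1 + ‖(β + s * I : ℂ)‖) ^ (-(3 / 2) : ℝ) ≤ 1 :=
    Real.rpow_le_one_of_one_le_of_nonpos (le_add_of_nonneg_right (norm_nonneg _)) (by norm_num)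
  rw [vacLaplace, norm_mul]
  calc _ ≤ ‖Fvac A (β + s * I) J‖ := mul_le_of_le_one_left (norm_nonneg _)
        (norm_half_mul_exp_neg_le_one hA.le (by simpa using hβ.le))
    _ ≤ C * cardyScale A J * (1 + ‖(β + s * I : ℂ)‖) ^ (-(3 / 2) : ℝ) := hFvac J _ hJ (by simp)
    _ ≤ |C| * cardyScale A J * 1 := by
        gcongr
        exact le_abs_self C
    _ = _ := mul_one _

theorem IsLargeSpin.integrable_vacLaplace {A β : ℝ} {J : ℤ} (hJ : IsLargeSpin A β J)
    (hA : 0 < A) : Integrable fun s : ℝ => vacLaplace A J (β + s * I) :=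
  (hJ.integrable_Fvac_vertical hA).bdd_mul (c := 1) (by fun_prop) <| .of_forall fun s =>
    norm_half_mul_exp_neg_le_one hA.le (by simpa using (hJ.abscissa_pos hA).le)

/-- What the primaries of the dual channel contribute to `laplace J w`. -/
def CFTData.laplaceRemainder (S : CFTData) (J : ℤ) (w : ℂ) : ℂ :=
  S.laplace J w - vacLaplace S.A J w

namespace CFTData.IsModularCFT

variable {S : CFTData}

theorem exp_mul_reducedZ_sub_vacIntegrand (hS : S.IsModularCFT) {w z : ℂ} (J : ℤ) (hz : 0 < z.re)
    (hw : 0 < (w - z).re) :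
    Complex.exp (z * J) * S.reducedZ (w - z) z - vacIntegrand S.A J w z =
      dualFactor S.A J w z * S.primarySum (4 * π ^ 2 / (w - z)) (4 * π ^ 2 / z) := by
  have hexp : (S.A : ℂ) * (4 * π ^ 2 / (w - z) + 4 * π ^ 2 / z) =
      4 * π ^ 2 * S.A / (w - z) + 4 * π ^ 2 * S.A / z := by ring
  rw [hS.reducedZ_inversion hw hz, mul_comm (w - z) z, reducedZ, hexp,
    vacIntegrand_eq_dualFactor_mul, dualFactor]
  ring

theorem laplaceRemainder_eq (hS : S.IsModularCFT) {β : ℝ} {J : ℤ} (hJ : IsLargeSpin S.A β J)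
    {w : ℂ} (hw : β ≤ w.re) :
    S.laplaceRemainder J w = 1 / 2 * Complex.exp (-(S.A * w)) *
      ∫ t in (-π)..π, (1 / (2 * π) : ℂ) * (dualFactor S.A J w (alphaJ S.A J + t * I) *
        S.primarySum (4 * π ^ 2 / (w - (alphaJ S.A J + t * I)))
          (4 * π ^ 2 / (alphaJ S.A J + t * I))) := by
  have hα := hJ.alphaJ_pos hS.A_pos
  have hαw : alphaJ S.A J < w.re := (hJ.alphaJ_lt hS.A_pos).trans_le hw
  have hvac : Continuous fun t : ℝ => vacIntegrand S.A J w (alphaJ S.A J + t * I) :=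
    continuous_vacIntegrand S.A J continuous_const (by fun_prop) (fun _ => by simpa using hα)
      (fun _ => by simpa using hαw)
  have hZ := hS.continuous_reducedZ_segment hα hαw
  have hexp : Complex.exp (-(S.A * w)) * Complex.exp (S.A * w) = 1 := by
    rw [← Complex.exp_add, neg_add_cancel, Complex.exp_zero]
  have hpi : (1 / (2 * π) : ℂ) * (2 * π) = 1 := by
    have : (π : ℂ) ≠ 0 := by exact_mod_cast Real.pi_ne_zero
    field_simp
  have hint : ∫ t in (-π)..π, (1 / (2 * π) : ℂ) * (dualFactor S.A J w (alphaJ S.A J + t * I) *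
        S.primarySum (4 * π ^ 2 / (w - (alphaJ S.A J + t * I)))
          (4 * π ^ 2 / (alphaJ S.A J + t * I))) =
      Complex.exp (S.A * w) * (2 * S.laplace J w) - Fvac S.A w J := by
    simp_rw [← hS.exp_mul_reducedZ_sub_vacIntegrand J
      (z := alphaJ S.A J + (_ : ℝ) * I) (by simpa using hα) (by simpa using hαw)]
    rw [intervalIntegral.integral_const_mul, intervalIntegral.integral_sub
      (Continuous.intervalIntegrable (by fun_prop) _ _) (hvac.intervalIntegrable _ _),
      hS.integral_exp_mul_reducedZ hα hαw hJ.two_le, Fvac, intervalIntegral.integral_const_mul,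
      mul_sub, ← mul_assoc, hpi, one_mul]
  rw [hint, laplaceRemainder, vacLaplace]
  linear_combination -S.laplace J w * hexp

theorem exists_norm_primarySum_dual_le (hS : S.IsModularCFT) {β : ℝ} (hβ : 0 < β) :
    ∃ C : ℝ, 1 ≤ C ∧ ∀ α s t : ℝ, 0 < α → α ≤ β / 2 → |t| ≤ π →
      ‖S.primarySum (4 * π ^ 2 / (β + s * I - (α + t * I))) (4 * π ^ 2 / (α + t * I))‖ ≤
        S.realPrimarySum (C * (1 + s ^ 2))⁻¹ (4 * π ^ 2 * α / (α ^ 2 + t ^ 2)) := by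
  obtain ⟨C, hC, hre⟩ := exists_inv_le_re_four_pi_sq_div_sub hβ
  refine ⟨C, hC, fun α s t hα hαβ ht => (norm_primarySum_le _ _).trans ?_⟩
  have hb : (4 * (π : ℂ) ^ 2 / (α + t * I)).re = 4 * π ^ 2 * α / (α ^ 2 + t ^ 2) := by
    simp [re_four_pi_sq_div, Complex.normSq_add_mul_I]
  rw [hb]
  exact hS.realPrimarySum_antitone (by positivity) (hre α s t hα.le hαβ ht) (by positivity) le_rfl

theorem exists_norm_dualFactor_mul_primarySum_le (hS : S.IsModularCFT) {β : ℝ} (hβ : 0 < β) :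
    ∃ C K κ : ℝ, 0 ≤ C ∧ 0 ≤ K ∧ 0 < κ ∧ ∀ (J : ℤ) (s t : ℝ), IsLargeSpin S.A β J → |t| ≤ π →
      ‖dualFactor S.A J (β + s * I) (alphaJ S.A J + t * I) *
          S.primarySum (4 * π ^ 2 / (β + s * I - (alphaJ S.A J + t * I)))
            (4 * π ^ 2 / (alphaJ S.A J + t * I))‖ ≤
        C * cardyScale S.A J * Real.exp (K * (1 + s ^ 2) - κ * √J) := by
  obtain ⟨C₀, K₀, κ₀, hC₀, hK₀, hκ₀, hcontour⟩ := hS.exists_exp_mul_realPrimarySum_contour_le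
  obtain ⟨C₁, hC₁, hprimary⟩ := hS.exists_norm_primarySum_dual_le hβ
  have hA := hS.A_pos
  set M : ℝ := 2 * π * Real.exp (8 * π ^ 2 * S.A / β)
  refine ⟨M * (√(β / 2))⁻¹ * C₀ * (4 * π ^ 2 * S.A)⁻¹, K₀ * C₁, κ₀ / (2 * π * √S.A),
    by positivity, by positivity, by positivity, fun J s t hJ ht => ?_⟩
  have hα := hJ.alphaJ_pos hA
  set α := alphaJ S.A J
  set a : ℝ := (C₁ * (1 + s ^ 2))⁻¹ with ha_def
  set b : ℝ := 4 * π ^ 2 * α / (α ^ 2 + t ^ 2)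
  set E : ℝ := Real.exp (2 * π * √(S.A * J))
  have ha : 0 < a := by positivity
  have ha_one : a ≤ 1 := inv_le_one_of_one_le₀ (by nlinarith [sq_nonneg s])
  have hfactor : ‖dualFactor S.A J (β + s * I) (α + t * I)‖ ≤
      M * (√(β / 2))⁻¹ * (E * α⁻¹) * Real.exp (S.A * b) := hJ.norm_dualFactor_vertical_le hA s t
  rw [norm_mul]
  calc _ ≤ M * (√(β / 2))⁻¹ * (E * α⁻¹) * Real.exp (S.A * b) * S.realPrimarySum a b :=
        mul_le_mul hfactor (hprimary α s t hα hJ.alphaJ_le_half ht) (norm_nonneg _) (by positivity)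
    _ = M * (√(β / 2))⁻¹ * (E * α⁻¹) * (Real.exp (S.A * b) * S.realPrimarySum a b) := by ring
    _ ≤ M * (√(β / 2))⁻¹ * (E * α⁻¹) *
          (C₀ * Real.exp (K₀ / a) * (α⁻¹ * Real.exp ((4 * π ^ 2 * S.A - κ₀) / α))) := by
        refine mul_le_mul_of_nonneg_left ?_ (by positivity)
        exact hcontour α t a hα hJ.alphaJ_le_one ht ha ha_one
    _ = M * (√(β / 2))⁻¹ * C₀ * Real.exp (K₀ / a) *
          (E * α⁻¹ * (α⁻¹ * Real.exp ((4 * π ^ 2 * S.A - κ₀) / α))) := by ring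
    _ = _ := by
        rw [hJ.exp_mul_inv_alphaJ_mul_eq hA, ha_def, div_inv_eq_mul, sub_eq_add_neg, Real.exp_add]
        ring_nf

theorem exists_norm_laplaceRemainder_le (hS : S.IsModularCFT) {β : ℝ} (hβ : 0 < β) :
    ∃ C K κ : ℝ, 0 ≤ C ∧ 0 ≤ K ∧ 0 < κ ∧ ∀ (J : ℤ) (s : ℝ), IsLargeSpin S.A β J →
      ‖S.laplaceRemainder J (β + s * I)‖ ≤
        C * cardyScale S.A J * Real.exp (K * (1 + s ^ 2) - κ * √J) := by
  obtain ⟨C, K, κ, hC, hK, hκ, hbound⟩ := hS.exists_norm_dualFactor_mul_primarySum_le hβ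
  refine ⟨C, K, κ, hC, hK, hκ, fun J s hJ => ?_⟩
  rw [hS.laplaceRemainder_eq hJ (by simp), norm_mul]
  exact (mul_le_of_le_one_left (norm_nonneg _) (norm_half_mul_exp_neg_le_one hS.A_pos.le
    (by simpa using hβ.le))).trans
    (norm_average_segment_le fun t ht => hbound J s t hJ ht)

-- The Laplace transform of a positive measure is largest on the real axis, that is at `s = 0`.
theorem exists_norm_laplaceRemainder_le_cardyScale (hS : S.IsModularCFT) {β : ℝ} (hβ : 0 < β) :
    ∃ C : ℝ, 0 ≤ C ∧ ∀ (J : ℤ) (s : ℝ), IsLargeSpin S.A β J →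
      ‖S.laplaceRemainder J (β + s * I)‖ ≤ C * cardyScale S.A J := by
  obtain ⟨C, K, κ, hC, -, hκ, hremainder⟩ := hS.exists_norm_laplaceRemainder_le hβ
  obtain ⟨C', hC', hvac⟩ := exists_norm_vacLaplace_le hS.A_pos hβ
  refine ⟨C * Real.exp K + C' + C', by positivity, fun J s hJ => ?_⟩
  have hscale := hJ.cardyScale_pos
  have hzero : ‖S.laplaceRemainder J (β + (0 : ℝ) * I)‖ ≤ C * Real.exp K * cardyScale S.A J := by
    have hexp : Real.exp (K * (1 + 0 ^ 2) - κ * √J) ≤ Real.exp K :=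
      Real.exp_le_exp.2 (by simpa using by positivity)
    calc _ ≤ C * cardyScale S.A J * Real.exp K := (hremainder J 0 hJ).trans (by gcongr)
      _ = _ := by ring
  have hlaplace : ‖S.laplace J (β + s * I)‖ ≤
      ‖S.laplaceRemainder J (β + (0 : ℝ) * I) + vacLaplace S.A J (β + (0 : ℝ) * I)‖ := by
    rw [laplaceRemainder, sub_add_cancel]
    simpa using norm_laplace_le (S := S) J (β + s * I)
  calc _ ≤ ‖S.laplaceRemainder J (β + (0 : ℝ) * I) + vacLaplace S.A J (β + (0 : ℝ) * I)‖ +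
        ‖vacLaplace S.A J (β + s * I)‖ :=
        (norm_sub_le _ _).trans (add_le_add_left hlaplace _)
    _ ≤ C * Real.exp K * cardyScale S.A J + C' * cardyScale S.A J + C' * cardyScale S.A J :=
        add_le_add ((norm_add_le _ _).trans (add_le_add hzero (hvac J 0 hJ))) (hvac J s hJ)
    _ = _ := by ring

end CFTData.IsModularCFT

/-! ### The smeared difference -/

/-- The spectral density of spin `J` minus the vacuum density, integrated against the test function
`g`; `β` is the abscissa of the inverse Laplace transform defining the latter. -/
def CFTData.smearedDifference (S : CFTData) (β : ℝ) (J : ℤ) (g : ℝ → ℂ) : ℂ :=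
  (∫ h in Ioi S.Tgap, g h ∂S.rhoH J) - ∫ h in Ioi S.Tgap, g h * rhoVac S.A β J h

theorem IsLargeSpin.integral_mul_rhoVac {A β : ℝ} {J : ℤ} (hJ : IsLargeSpin A β J) (hA : 0 < A)
    {g : ℝ → ℂ} (hg : Continuous g) (hc : HasCompactSupport g) :
    ∫ h, g h * rhoVac A β J h = ∫ s : ℝ, testTransform g (β + s * I) *
      vacLaplace A J (β + s * I) := by
  rw [← integral_mul_integral_exp (hJ.integrable_vacLaplace hA) hg hc]
  refine integral_congr_ae (.of_forall fun h => ?_)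
  dsimp only
  rw [rhoVac, ← integral_const_mul, ← integral_const_mul (1 / (2 * π) : ℂ), ← integral_const_mul,
    ← integral_const_mul]
  refine integral_congr_ae (.of_forall fun s => ?_)
  dsimp only
  have hexp : Complex.exp ((β + s * I) * (h - A)) =
      Complex.exp (-(A * (β + s * I))) * Complex.exp ((β + s * I) * h) := by
    rw [← Complex.exp_add]
    ring_nf
  rw [rhoVacIntegrand, vacLaplace, hexp]
  ring

namespace CFTData.IsModularCFT

variable {S : CFTData} {β : ℝ} {J : ℤ}

theorem setIntegral_mul_rhoVac (hS : S.IsModularCFT) (hJ : IsLargeSpin S.A β J) (g : ℝ → ℂ) :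
    ∫ h in Ioi S.Tgap, g h * rhoVac S.A β J h = ∫ h, g h * rhoVac S.A β J h := by
  refine setIntegral_eq_integral_of_forall_compl_eq_zero fun h hh => ?_
  rw [hJ.rhoVac_eq_zero hS.A_pos ((not_lt.1 hh).trans hS.Tgap_le_A), mul_zero]

theorem smearedDifference_eq (hS : S.IsModularCFT) (hJ : IsLargeSpin S.A β J) {g : ℝ → ℂ}
    (hg : ContDiff ℝ ∞ g) (hc : HasCompactSupport g) :
    S.smearedDifference β J g =
      ∫ s : ℝ, testTransform g (β + s * I) * S.laplaceRemainder J (β + s * I) := by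
  have hA := hS.A_pos
  have hβ := hJ.abscissa_pos hA
  have := hS.isFiniteMeasureOnCompacts_rhoH J
  have htransform := integrable_testTransform_vertical hg hc β
  have hvac : Integrable fun s : ℝ =>
      testTransform g (β + s * I) * vacLaplace S.A J (β + s * I) := by
    obtain ⟨C, -, hC⟩ := exists_norm_vacLaplace_le hA hβ
    exact htransform.mul_bdd (hJ.integrable_vacLaplace hA).aestronglyMeasurable
      (.of_forall fun s => hC J s hJ)
  have hlaplace : Integrable fun s : ℝ =>
      testTransform g (β + s * I) * S.laplace J (β + s * I) :=
    htransform.mul_bdd (hS.continuous_laplace_vertical J hβ).aestronglyMeasurable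
      (.of_forall fun s => by simpa using norm_laplace_le (S := S) J (β + s * I))
  rw [smearedDifference, hS.rhoH_restrict, hS.setIntegral_mul_rhoVac hJ,
    integral_eq_integral_testTransform_mul (hS.integrable_exp_rhoH J hβ) hg hc,
    hJ.integral_mul_rhoVac hA hg.continuous hc]
  simp_rw [laplaceRemainder, mul_sub]
  exact (integral_sub hlaplace hvac).symm

theorem integrableOn_rhoH (hS : S.IsModularCFT) (J : ℤ) {g : ℝ → ℂ} (hg : Continuous g)
    (hc : HasCompactSupport g) : IntegrableOn g (Ioi S.Tgap) (S.rhoH J) :=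
  have := hS.isFiniteMeasureOnCompacts_rhoH J
  (hg.integrable_of_hasCompactSupport hc).integrableOn

theorem integrableOn_mul_rhoVac (hS : S.IsModularCFT) (hJ : IsLargeSpin S.A β J) {g : ℝ → ℂ}
    (hg : Continuous g) (hc : HasCompactSupport g) :
    IntegrableOn (fun h => g h * rhoVac S.A β J h) (Ioi S.Tgap) :=
  ((hg.mul (hJ.continuous_rhoVac hS.A_pos)).integrable_of_hasCompactSupport
    hc.mul_right).integrableOn

theorem exists_norm_testTransform_mul_laplaceRemainder_le_of_abs_le (hS : S.IsModularCFT)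
    (hβ : 0 < β) {φ : ℝ → ℂ} (hφ : ContDiff ℝ ∞ φ) (hs : HasCompactSupport φ) (Λ b : ℝ) :
    ∃ C K κ : ℝ, 0 ≤ C ∧ 0 < κ ∧ ∀ (J : ℤ) (lam hstar T s : ℝ), IsLargeSpin S.A β J →
      0 < lam → lam ≤ Λ → hstar ≤ b → |s| ≤ T →
      ‖testTransform (rescale φ hstar lam) (β + s * I) * S.laplaceRemainder J (β + s * I)‖ ≤
        C * cardyScale S.A J * (lam ^ 2)⁻¹ * Real.exp (K * (1 + T ^ 2) - κ * √J) *
          (‖(β + s * I : ℂ)‖ ^ 2)⁻¹ := by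
  obtain ⟨C, K, κ, hC, hK, hκ, hremainder⟩ := hS.exists_norm_laplaceRemainder_le hβ
  obtain ⟨D, hD, htransform⟩ := exists_norm_testTransform_rescale_le hφ hs hβ Λ b 2
  refine ⟨D * C, K, κ, by positivity, hκ, fun J lam hstar T s hJ hlam hΛ hb hsT => ?_⟩
  have hscale := hJ.cardyScale_pos
  have hsq : s ^ 2 ≤ T ^ 2 := sq_le_sq' (abs_le.1 hsT).1 (abs_le.1 hsT).2
  rw [norm_mul]
  calc _ ≤ D * ((lam * ‖(β + s * I : ℂ)‖) ^ 2)⁻¹ *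
        (C * cardyScale S.A J * Real.exp (K * (1 + T ^ 2) - κ * √J)) := by
        gcongr
        · exact htransform lam hstar s hlam hΛ hb
        · exact (hremainder J s hJ).trans (by gcongr)
    _ = _ := by
        rw [mul_pow, mul_inv]
        ring

theorem exists_norm_testTransform_mul_laplaceRemainder_le_of_le_abs (hS : S.IsModularCFT)
    (hβ : 0 < β) {φ : ℝ → ℂ} (hφ : ContDiff ℝ ∞ φ) (hs : HasCompactSupport φ) (Λ b : ℝ) (N : ℕ) :
    ∃ C : ℝ, 0 ≤ C ∧ ∀ (J : ℤ) (lam hstar T s : ℝ), IsLargeSpin S.A β J →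
      0 < lam → lam ≤ Λ → hstar ≤ b → 0 < T → T ≤ |s| →
      ‖testTransform (rescale φ hstar lam) (β + s * I) * S.laplaceRemainder J (β + s * I)‖ ≤
        C * cardyScale S.A J * (lam ^ 2)⁻¹ * ((lam * T) ^ N)⁻¹ *
          (‖(β + s * I : ℂ)‖ ^ 2)⁻¹ := by
  obtain ⟨C, hC, hremainder⟩ := hS.exists_norm_laplaceRemainder_le_cardyScale hβ
  obtain ⟨D, hD, htransform⟩ := exists_norm_testTransform_rescale_le hφ hs hβ Λ b (N + 2)
  refine ⟨D * C, by positivity, fun J lam hstar T s hJ hlam hΛ hb hT hsT => ?_⟩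
  have hscale := hJ.cardyScale_pos
  have hnorm : T ≤ ‖(β + s * I : ℂ)‖ :=
    hsT.trans (by simpa using Complex.abs_im_le_norm (β + s * I))
  rw [norm_mul]
  calc _ ≤ D * ((lam * ‖(β + s * I : ℂ)‖) ^ (N + 2))⁻¹ * (C * cardyScale S.A J) := by
        gcongr
        · exact htransform lam hstar s hlam hΛ hb
        · exact hremainder J s hJ
    _ ≤ D * (((lam * T) ^ N)⁻¹ * ((lam * ‖(β + s * I : ℂ)‖) ^ 2)⁻¹) *
        (C * cardyScale S.A J) := by
        rw [pow_add, mul_inv]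
        gcongr
    _ = _ := by
        rw [mul_pow _ _ 2, mul_inv (lam ^ 2)]
        ring

-- For `|s| ≤ T` the remainder is exponentially small, for `|s| ≥ T` the transform decays.
theorem exists_norm_smearedDifference_le (hS : S.IsModularCFT) (hβ : 0 < β)
    {φ : ℝ → ℂ} (hφ : ContDiff ℝ ∞ φ) (hs : HasCompactSupport φ) (Λ b : ℝ) (N : ℕ) :
    ∃ C K κ : ℝ, 0 ≤ C ∧ 0 < κ ∧ ∀ (J : ℤ) (lam hstar T : ℝ), IsLargeSpin S.A β J →
      0 < lam → lam ≤ Λ → hstar ≤ b → 0 < T →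
      ‖S.smearedDifference β J (rescale φ hstar lam)‖ ≤
        C * cardyScale S.A J * (lam ^ 2)⁻¹ *
          (Real.exp (K * (1 + T ^ 2) - κ * √J) + ((lam * T) ^ N)⁻¹) := by
  obtain ⟨C₁, K, κ, hC₁, hκ, hlow⟩ :=
    hS.exists_norm_testTransform_mul_laplaceRemainder_le_of_abs_le hβ hφ hs Λ b
  obtain ⟨C₂, hC₂, hhigh⟩ :=
    hS.exists_norm_testTransform_mul_laplaceRemainder_le_of_le_abs hβ hφ hs Λ b N
  refine ⟨(C₁ + C₂) * ∫ s : ℝ, (‖(β + s * I : ℂ)‖ ^ 2)⁻¹, K, κ,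
    mul_nonneg (by positivity) (integral_nonneg fun s => by positivity), hκ,
    fun J lam hstar T hJ hlam hΛ hb hT => ?_⟩
  have hscale := hJ.cardyScale_pos
  have hpointwise (s : ℝ) :
      ‖testTransform (rescale φ hstar lam) (β + s * I) * S.laplaceRemainder J (β + s * I)‖ ≤
        (C₁ + C₂) * cardyScale S.A J * (lam ^ 2)⁻¹ *
          (Real.exp (K * (1 + T ^ 2) - κ * √J) + ((lam * T) ^ N)⁻¹) *
          (‖(β + s * I : ℂ)‖ ^ 2)⁻¹ := by
    rcases le_total |s| T with hsT | hsT
    · refine (hlow J lam hstar T s hJ hlam hΛ hb hsT).trans ?_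
      gcongr
      exacts [le_add_of_nonneg_right hC₂, le_add_of_nonneg_right (by positivity)]
    · refine (hhigh J lam hstar T s hJ hlam hΛ hb hT hsT).trans ?_
      gcongr
      exacts [le_add_of_nonneg_left hC₁, le_add_of_nonneg_left (Real.exp_nonneg _)]
  rw [hS.smearedDifference_eq hJ (contDiff_rescale hφ _ _)
    (hasCompactSupport_rescale hs hstar hlam.ne')]
  refine (norm_integral_le_of_norm_le ((integrable_inv_sq_norm_vertical hβ.ne').const_mul _)
    (.of_forall hpointwise)).trans_eq ?_
  rw [integral_const_mul]
  ring

end CFTData.IsModularCFT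

section Asymptotics

theorem tendsto_pow_mul_exp_neg_mul_sqrt {κ : ℝ} (hκ : 0 < κ) (n : ℕ) :
    Tendsto (fun x : ℝ => x ^ n * Real.exp (-κ * √x)) atTop (𝓝 0) := by
  refine ((tendsto_rpow_mul_exp_neg_mul_atTop_nhds_zero (2 * n : ℕ) κ hκ).comp
    Real.tendsto_sqrt_atTop).congr' ?_
  filter_upwards [eventually_ge_atTop 0] with x hx
  rw [Function.comp_apply, Real.rpow_natCast, pow_mul, Real.sq_sqrt hx]

theorem tendsto_pow_mul_exp_sub_mul_sqrt {κ ε : ℝ} (K : ℝ) (hκ : 0 < κ) (hε : 0 < ε) (n : ℕ) :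
    Tendsto (fun x : ℝ => x ^ n * Real.exp (K * (1 + (x ^ (1 / 4 - ε / 2)) ^ 2) - κ * √x))
      atTop (𝓝 0) := by
  have hmajorant := (tendsto_pow_mul_exp_neg_mul_sqrt (half_pos hκ) n).const_mul (Real.exp K)
  have hsmall : ∀ᶠ x : ℝ in atTop, K * x ^ (-ε) ≤ κ / 2 :=
    ((tendsto_rpow_neg_atTop hε).const_mul K).eventually_le_const (by simpa using half_pos hκ)
  rw [mul_zero] at hmajorant
  refine squeeze_zero' ?_ ?_ hmajorant
  · filter_upwards [eventually_ge_atTop 0] with x hx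
    positivity
  · filter_upwards [eventually_gt_atTop 0, hsmall] with x hx hKx
    have hsq : (x ^ (1 / 4 - ε / 2)) ^ 2 = x ^ (-ε) * √x := by
      rw [Real.sqrt_eq_rpow, ← Real.rpow_add hx, ← Real.rpow_mul_natCast hx.le]
      push_cast
      ring_nf
    have hexponent : K * (1 + x ^ (-ε) * √x) - κ * √x ≤ K + -(κ / 2) * √x := by
      linarith [mul_le_mul_of_nonneg_right hKx (Real.sqrt_nonneg x)]
    rw [hsq, mul_left_comm, ← Real.exp_add]
    gcongr

theorem tendsto_pow_mul_inv_rpow_pow (δ : ℝ) {ε : ℝ} {n N : ℕ} (hN : n < ε / 2 * N) :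
    Tendsto (fun x : ℝ => x ^ n * ((δ * x ^ (ε / 2)) ^ N)⁻¹) atTop (𝓝 0) := by
  have h := (tendsto_rpow_neg_atTop (sub_pos.2 hN)).const_mul (δ ^ N)⁻¹
  rw [mul_zero] at h
  refine h.congr' ?_
  filter_upwards [eventually_gt_atTop 0] with x hx
  rw [neg_sub, Real.rpow_sub hx, Real.rpow_natCast, Real.rpow_mul_natCast hx.le, mul_pow, mul_inv]
  ring

theorem inv_sq_le_of_div_rpow_le {δ ε x l : ℝ} (hδ : 0 < δ) (hε : 0 < ε) (hx : 1 ≤ x)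
    (hl : δ / x ^ (1 / 4 - ε) ≤ l) : (l ^ 2)⁻¹ ≤ (δ ^ 2)⁻¹ * x := by
  have hx_pos : 0 < x := one_pos.trans_le hx
  have hpow : x ^ (1 / 4 - ε) ≤ √x := by
    rw [Real.sqrt_eq_rpow]
    exact Real.rpow_le_rpow_of_exponent_le hx (by linarith)
  calc (l ^ 2)⁻¹ ≤ ((δ / √x) ^ 2)⁻¹ := by
        gcongr
        exact le_trans (by gcongr) hl
    _ = (δ ^ 2)⁻¹ * x := by
        rw [div_pow, Real.sq_sqrt hx_pos.le, inv_div, div_eq_inv_mul]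

theorem mul_rpow_le_mul_rpow_of_div_rpow_le {δ ε x l : ℝ} (hx : 0 < x)
    (hl : δ / x ^ (1 / 4 - ε) ≤ l) : δ * x ^ (ε / 2) ≤ l * x ^ (1 / 4 - ε / 2) := by
  calc δ * x ^ (ε / 2) = δ / x ^ (1 / 4 - ε) * x ^ (1 / 4 - ε / 2) := by
        rw [div_mul_eq_mul_div, mul_div_assoc, ← Real.rpow_sub hx]
        ring_nf
    _ ≤ l * x ^ (1 / 4 - ε / 2) := by gcongr


theorem eventually_sq_mul_exp_add_inv_pow_le {ε δ κ : ℝ} (hε : 0 < ε) (hκ : 0 < κ)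
    (D K : ℝ) {κ' : ℝ} (hκ' : 0 < κ') {p N : ℕ} (hN : (p + 3 : ℕ) < ε / 2 * N) :
    ∀ᶠ x : ℝ in atTop,
      D * x ^ 2 * (Real.exp (K * (1 + (x ^ (1 / 4 - ε / 2)) ^ 2) - κ * √x) +
        ((δ * x ^ (ε / 2)) ^ N)⁻¹) ≤ 1 / √(2 * x) * (κ' * (x ^ p)⁻¹) := by
  have hlim := ((tendsto_pow_mul_exp_sub_mul_sqrt K hκ hε (p + 3)).add
    (tendsto_pow_mul_inv_rpow_pow δ hN)).const_mul (2 * D)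
  rw [add_zero, mul_zero] at hlim
  filter_upwards [eventually_ge_atTop 1, hlim.eventually_le_const hκ'] with x hx hle
  have hx_pos : 0 < x := one_pos.trans_le hx
  have hsqrt : √(2 * x) ≤ 2 * x := Real.sqrt_le_self_iff.2 (.inr (by linarith))
  rw [← mul_add] at hle
  generalize Real.exp _ + _ = Q at hle ⊢
  calc D * x ^ 2 * Q = 1 / (2 * x) * (2 * D * (x ^ (p + 3) * Q) * (x ^ p)⁻¹) := by
        field_simp
        ring
    _ ≤ 1 / (2 * x) * (κ' * (x ^ p)⁻¹) := by gcongr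
    _ ≤ 1 / √(2 * x) * (κ' * (x ^ p)⁻¹) := by gcongr

end Asymptotics

theorem CFTData.IsModularCFT.eventually_norm_smearedDifference_le {S : CFTData}
    (hS : S.IsModularCFT) {φ : ℝ → ℂ} (hφ : ContDiff ℝ ∞ φ) (hs : HasCompactSupport φ)
    {ε δ Λ β κ : ℝ} (hε : 0 < ε) (hδ : 0 < δ) (hβ : 0 < β) (hκ : 0 < κ) {lam : ℤ → ℝ}
    (hlam : ∀ᶠ J : ℤ in atTop, δ / (J : ℝ) ^ (1 / 4 - ε) ≤ lam J)
    (hΛ : ∀ᶠ J : ℤ in atTop, lam J ≤ Λ) (p : ℕ) (b : ℝ) :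
    ∀ᶠ J : ℤ in atTop, ∀ hstar ≤ b,
      ‖S.smearedDifference β J (rescale φ hstar (lam J))‖ ≤
        1 / √(2 * J) * Real.exp (4 * π * √(S.A * J)) * (κ * ((J : ℝ) ^ p)⁻¹) := by
  obtain ⟨N, hN⟩ : ∃ N : ℕ, (p + 3 : ℕ) < ε / 2 * N :=
    (exists_nat_gt ((p + 3 : ℕ) / (ε / 2))).imp fun N h => (div_lt_iff₀' (half_pos hε)).1 h
  obtain ⟨C, K, κ₀, hC, hκ₀, hbound⟩ := hS.exists_norm_smearedDifference_le hβ hφ hs Λ b N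
  filter_upwards [eventually_isLargeSpin S.A hβ, hlam, hΛ, tendsto_intCast_atTop_atTop.eventually
    (eventually_sq_mul_exp_add_inv_pow_le (δ := δ) hε hκ₀ (C * (δ ^ 2)⁻¹) K hκ hN)]
    with J hJ hlam hΛ herror hstar hb
  have hJ_pos := hJ.cast_pos
  have hJ_one : (1 : ℝ) ≤ J := by exact_mod_cast one_le_two.trans hJ.two_le
  have hlam_pos : 0 < lam J := lt_of_lt_of_le (by positivity) hlam
  set Q : ℝ → ℝ := fun l => Real.exp (K * (1 + ((J : ℝ) ^ (1 / 4 - ε / 2)) ^ 2) - κ₀ * √J) +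
    (l ^ N)⁻¹ with hQ
  have hQ_le : Q (lam J * (J : ℝ) ^ (1 / 4 - ε / 2)) ≤ Q (δ * (J : ℝ) ^ (ε / 2)) := by
    have := mul_rpow_le_mul_rpow_of_div_rpow_le hJ_pos hlam
    simp only [hQ]
    gcongr
  calc _ ≤ C * cardyScale S.A J * (lam J ^ 2)⁻¹ * Q (lam J * (J : ℝ) ^ (1 / 4 - ε / 2)) :=
        hbound J (lam J) hstar _ hJ hlam_pos hΛ hb (by positivity)
    _ ≤ C * cardyScale S.A J * ((δ ^ 2)⁻¹ * J) * Q (δ * (J : ℝ) ^ (ε / 2)) := by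
        have := hJ.cardyScale_pos
        gcongr
        exact inv_sq_le_of_div_rpow_le hδ hε hJ_one hlam
    _ = Real.exp (4 * π * √(S.A * J)) * (C * (δ ^ 2)⁻¹ * J ^ 2 * Q (δ * (J : ℝ) ^ (ε / 2))) := by
        rw [cardyScale]
        ring
    _ ≤ Real.exp (4 * π * √(S.A * J)) * (1 / √(2 * J) * (κ * ((J : ℝ) ^ p)⁻¹)) := by gcongr
    _ = _ := by ring

end

theorem theorem1 (S : CFTData) (hS : S.IsModularCFT)
    (R : ℝ) (φ : ℝ → ℂ) (hφ : ContDiff ℝ ∞ φ) (hφR : tsupport φ ⊆ Icc (-R) R)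
    (ε δ : ℝ) (hε : 0 < ε) (hδ : 0 < δ)
    (lam : ℤ → ℝ)
    (hlam : ∀ᶠ J : ℤ in atTop, δ / (J : ℝ) ^ (1 / 4 - ε) ≤ lam J)
    (hlam_bdd : ∃ Λ : ℝ, ∀ᶠ J : ℤ in atTop, lam J ≤ Λ)
    (β : ℝ) (hβ : 0 < β) :
    -- all integrals in the formula converge absolutely for large `J`
    (∀ᶠ J : ℤ in atTop,
      (∀ h : ℝ, Integrable (rhoVacIntegrand S.A β J h)) ∧
      ∀ hstar : ℝ,
        IntegrableOn (rescale φ hstar (lam J)) (Ioi S.Tgap) (S.rhoH J) ∧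
        IntegrableOn (fun h => rescale φ hstar (lam J) h * rhoVac S.A β J h) (Ioi S.Tgap)) ∧
    -- the error is `(2J)^{-1/2} e^{4π√(AJ)} o(J^{-p})`, uniformly for `hstar` in `[a, b]`
    ∀ (p : ℕ) (a b κ : ℝ), 0 < κ → ∀ᶠ J : ℤ in atTop, ∀ hstar ∈ Icc a b,
      ‖(∫ h in Ioi S.Tgap, rescale φ hstar (lam J) h ∂(S.rhoH J)) -
          ∫ h in Ioi S.Tgap, rescale φ hstar (lam J) h * rhoVac S.A β J h‖ ≤
        1 / √(2 * J) * Real.exp (4 * π * √(S.A * J)) * (κ * ((J : ℝ) ^ p)⁻¹) := by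
  have hs : HasCompactSupport φ := isCompact_Icc.of_isClosed_subset (isClosed_tsupport φ) hφR
  refine ⟨?_, fun p a b κ hκ => ?_⟩
  · filter_upwards [eventually_isLargeSpin S.A hβ, hlam] with J hJ hlam
    have hJ_pos := hJ.cast_pos
    have hlam_pos : 0 < lam J := lt_of_lt_of_le (by positivity) hlam
    refine ⟨hJ.integrable_rhoVacIntegrand hS.A_pos, fun hstar => ?_⟩
    have hcont := (contDiff_rescale hφ hstar (lam J)).continuous
    have hsupp := hasCompactSupport_rescale hs hstar hlam_pos.ne'
    exact ⟨hS.integrableOn_rhoH J hcont hsupp, hS.integrableOn_mul_rhoVac hJ hcont hsupp⟩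
  · obtain ⟨Λ, hΛ⟩ := hlam_bdd
    exact (hS.eventually_norm_smearedDifference_le hφ hs hε hδ hβ hκ hlam hΛ p b).mono
      fun J hJ hstar hmem => hJ hstar hmem.2
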